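/- Let $\mathbb{D}$ be the open unit disc, $\mathbb{T}$ the unit circle and $m$ the normalized Lebesgue measure on $\mathbb{T}$. For $0<p<\infty$, the Hardy space $H^p$ consists of the functions $f$ analytic in $\mathbb{D}$ with $\|f\|_p^p := \sup_{0<r<1}\int_{\mathbb{T}}|f(r\zeta)|^p\,dm(\zeta)<\infty$. Let $b$ be an element of the closed unit ball of $H^\infty$ (that is, $b$ is analytic in $\mathbb{D}$ and $|b|\le 1$) which is not an extreme point of this unit ball. Let $\mathcal{H}(b)$ be the de Branges–Rovnyak space, i.e. the Hilbert space of functions on $\mathbb{D}$ with reproducing kernel $$k_b(\lambda,z)=\frac{1-\overline{b(\lambda)}\,b(z)}{1-\overline{\lambda}z},\qquad \lambda,z\in\mathbb{D}.$$ Let $a$ be a Pythagorean mate of $b$: an outer function, i.e. $a(z)=c\exp\int_{\mathbb{T}}\frac{\zeta+z}{\zeta-z}u(\zeta)\,dm(\zeta)$ with $|c|=1$ and $u\in L^1(\mathbb{T})$ real-valued, which lies in the closed unit ball of $H^\infty$ and satisfies $|a|^2+|b|^2=1$ almost everywhere on $\mathbb{T}$ in the sense of radial limits, i.e. $\lim_{r\to1^-}\big(|a(r\zeta)|^2+|b(r\zeta)|^2\big)=1$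 for almost every $\zeta\in\mathbb{T}$. Put $\phi=b/a$. Let $p\in(2,\infty)$ and $\tilde p=\frac{2p}{p-2}$. Then: 1. $H^p\subset\mathcal{H}(b)$ if and only if $\phi\in H^{\tilde p}$. 2. The containment $H^p\subset\mathcal{H}(b)$ is never compact: it is not the case that $H^p\subset\mathcal{H}(b)$ and that the closed unit ball of $H^p$ is relatively compact in the norm of $\mathcal{H}(b)$. -/

import Mathlib

open scoped ComplexConjugate ComplexOrder Topology Complex.UnitDisc
open Set Filter MeasureTheory

noncomputable section

/-- Extension by zero to the whole plane of a function on the open unit disc. -/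
def discExt (f : 𝔻 → ℂ) (z : ℂ) : ℂ :=
  if h : ‖z‖ < 1 then f (Complex.UnitDisc.mk z h) else 0

/-- `f` is analytic (holomorphic) in the open unit disc. -/
def IsAnalyticOnDisc (f : 𝔻 → ℂ) : Prop :=
  DifferentiableOn ℂ (discExt f) (Metric.ball 0 1)

/-- The integral mean `∫_𝕋 |f(rζ)|^p dm(ζ)`, with `m` the normalized Lebesgue measure. -/
def hardyMean (p : ℝ) (f : 𝔻 → ℂ) (r : ℝ) : ℝ :=
  Real.circleAverage (fun z => ‖discExt f z‖ ^ p) 0 r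

/-- The Hardy space `H^p`, `0 < p < ∞`. -/
def hardySpace (p : ℝ) : Set (𝔻 → ℂ) :=
  {f | IsAnalyticOnDisc f ∧ BddAbove (hardyMean p f '' Ioo 0 1)}

/-- The norm `‖f‖_p = (sup_{0<r<1} ∫_𝕋 |f(rζ)|^p dm(ζ))^{1/p}` of `f ∈ H^p`. -/
def hardyNorm (p : ℝ) (f : 𝔻 → ℂ) : ℝ :=
  sSup (hardyMean p f '' Ioo 0 1) ^ (1 / p)

/-- The closed unit ball of `H^∞`, the algebra of bounded analytic functions in the disc. -/
def hInftyUnitBall : Set (𝔻 → ℂ) :=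
  {f | IsAnalyticOnDisc f ∧ ∀ z, ‖f z‖ ≤ 1}

/-- The de Branges–Rovnyak kernel, as a function of `z` the reproducing kernel at `w`:
`(1 - conj (b w) * b z) / (1 - conj w * z)`. -/
def dbrKernel (b : 𝔻 → ℂ) : Matrix 𝔻 𝔻 (ℂ →L[ℂ] ℂ) :=
  Matrix.of fun z w =>
    ((1 - conj (b w) * b z) / (1 - conj (w : ℂ) * (z : ℂ))) • (1 : ℂ →L[ℂ] ℂ)

theorem discExt_coe (f : 𝔻 → ℂ) (z : 𝔻) : discExt f z = f z := by
  simp [discExt, z.norm_lt_one]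

/-- The positivity of the kernel at radius `r < 1`. -/
theorem dbrKernel_aux (B : ℂ → ℂ) (hB : DifferentiableOn ℂ B (Metric.ball 0 1))
    (hB1 : ∀ z, ‖B z‖ ≤ 1) (s : Finset 𝔻) (v : 𝔻 → ℂ) (r : ℝ) (hr0 : 0 < r) (hr1 : r < 1)
    (hs : ∀ w ∈ s, ‖(w : ℂ)‖ < r) :
    0 ≤ (∑ w ∈ s, ∑ x ∈ s, conj (v w) * v x *
      ((1 - conj (B x) * B w) * (r ^ 2 / (r ^ 2 - conj (x : ℂ) * w)))).re := by
  set k : 𝔻 → ℂ → ℂ := fun x ζ => r ^ 2 / (r ^ 2 - conj (x : ℂ) * ζ) with hk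
  set U : ℂ → ℂ := fun ζ => ∑ x ∈ s, v x * k x ζ with hU
  set V : ℂ → ℂ := fun ζ => ∑ x ∈ s, v x * conj (B x) * k x ζ with hV
  have hne : ∀ x ∈ s, ∀ ζ : ℂ, ‖ζ‖ ≤ r → (r : ℂ) ^ 2 - conj (x : ℂ) * ζ ≠ 0 := by
    intro x hx ζ hζ h
    have h1 : ‖(r : ℂ) ^ 2‖ = ‖conj (x : ℂ) * ζ‖ := by rw [sub_eq_zero.1 h]
    rw [norm_mul, norm_pow, Complex.norm_real, RCLike.norm_conj, Real.norm_of_nonneg hr0.le] at h1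
    have := hs x hx
    nlinarith [norm_nonneg ζ, norm_nonneg (x : ℂ)]
  have hball : Metric.closedBall (0 : ℂ) r ⊆ Metric.ball 0 1 :=
    Metric.closedBall_subset_ball hr1
  have hkd : ∀ x ∈ s, DifferentiableOn ℂ (k x) (Metric.closedBall 0 r) := by
    intro x hx
    refine DifferentiableOn.div (by fun_prop) (by fun_prop) ?_
    intro ζ hζ
    exact hne x hx ζ (by simpa using hζ)
  have hUd : DifferentiableOn ℂ U (Metric.closedBall 0 r) :=
    DifferentiableOn.fun_sum fun x hx => (hkd x hx).const_mul _
  have hVd : DifferentiableOn ℂ V (Metric.closedBall 0 r) :=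
    DifferentiableOn.fun_sum fun x hx => (hkd x hx).const_mul _
  have hBd := hB.mono hball
  set F : 𝔻 → ℂ → ℂ := fun w ζ => B w * V ζ + U ζ - 2 * (B ζ * V ζ) with hF
  have hFd : ∀ w, DifferentiableOn ℂ (F w) (Metric.closedBall 0 r) := fun w =>
    ((hVd.const_mul _).add hUd).sub ((hBd.mul hVd).const_mul _)
  have hav : ∀ w ∈ s, Real.circleAverage (fun ζ => ((ζ - 0) / (ζ - w)) • F w ζ) 0 r = F w w := by
    intro w hw
    refine DiffContOnCl.circleAverage_smul_div ?_ ?_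
    · rw [abs_of_pos hr0]
      refine DifferentiableOn.diffContOnCl ?_
      rw [closure_ball _ hr0.ne']
      exact hFd w
    · rw [abs_of_pos hr0]; simpa using hs w hw
  have hint : ∀ w ∈ s, CircleIntegrable (fun ζ => conj (v w) • ((ζ - 0) / (ζ - w)) • F w ζ) 0 r := by
    intro w hw
    refine ContinuousOn.circleIntegrable hr0.le ?_
    have h1 : ContinuousOn (F w) (Metric.sphere 0 r) :=
      (hFd w).continuousOn.mono Metric.sphere_subset_closedBall
    have h0 : ContinuousOn (fun ζ : ℂ => (ζ - 0) / (ζ - w)) (Metric.sphere 0 r) := by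
      refine ContinuousOn.div (by fun_prop) (by fun_prop) ?_
      intro ζ hζ h
      have h2 : ‖ζ‖ = r := by simpa using hζ
      rw [sub_eq_zero.1 h] at h2
      exact (hs w hw).ne h2
    exact ContinuousOn.const_smul (c := conj (v w)) (h0.smul h1)
  set E : ℂ → ℂ := fun ζ => ∑ w ∈ s, conj (v w) • ((ζ - 0) / (ζ - w)) • F w ζ with hE
  have hEI : CircleIntegrable E 0 r := CircleIntegrable.fun_sum s hint
  have hEav : Real.circleAverage E 0 r = ∑ w ∈ s, ∑ x ∈ s, conj (v w) * v x *
      ((1 - conj (B x) * B w) * (r ^ 2 / (r ^ 2 - conj (x : ℂ) * w))) := by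
    rw [hE, Real.circleAverage_fun_sum hint]
    refine Finset.sum_congr rfl fun w hw => ?_
    rw [Real.circleAverage_fun_smul, hav w hw]
    simp only [hF, hU, hV, hk, smul_eq_mul, Finset.mul_sum, mul_add, mul_sub,
      ← Finset.sum_add_distrib, ← Finset.sum_sub_distrib]
    refine Finset.sum_congr rfl fun x hx => ?_
    ring
  rw [← hEav]
  have hre : (Real.circleAverage E 0 r).re = Real.circleAverage (fun ζ => (E ζ).re) 0 r :=
    (ContinuousLinearMap.circleAverage_comp_comm Complex.reCLM hEI).symm
  rw [hre]
  refine Real.circleAverage_nonneg_of_nonneg ?_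
  intro ζ hζ
  have hζr : ‖ζ‖ = r := by simpa [abs_of_pos hr0] using hζ
  have hkc : ∀ x ∈ s, conj (k x ζ) = ζ / (ζ - x) := by
    intro x hx
    have h0 : ζ ≠ 0 := by rw [← norm_pos_iff, hζr]; exact hr0
    have hrr : (r : ℂ) ^ 2 = ζ * conj ζ := by
      rw [Complex.mul_conj, Complex.normSq_eq_norm_sq, hζr]; push_cast; rfl
    have h3 : ζ - x ≠ 0 := by
      intro h
      rw [sub_eq_zero.1 h] at hζr
      exact (hs x hx).ne hζr
    have hc : conj ζ ≠ 0 := by simpa using h0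
    have h4 : conj (k x ζ) = (r : ℂ) ^ 2 / (r ^ 2 - x * conj ζ) := by
      simp [hk]
    rw [h4, hrr, ← sub_mul, mul_div_mul_right _ _ hc]
  have hEζ : E ζ = conj (V ζ) * V ζ + conj (U ζ) * U ζ - 2 * (B ζ * V ζ * conj (U ζ)) := by
    have e1 : conj (V ζ) = ∑ x ∈ s, conj (v x) * B x * (ζ / (ζ - x)) := by
      simp only [hV, map_sum, map_mul, Complex.conj_conj]
      exact Finset.sum_congr rfl fun x hx => by rw [hkc x hx]
    have e2 : conj (U ζ) = ∑ x ∈ s, conj (v x) * (ζ / (ζ - x)) := by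
      simp only [hU, map_sum, map_mul]
      exact Finset.sum_congr rfl fun x hx => by rw [hkc x hx]
    rw [e1, e2]
    simp only [hE, hF, smul_eq_mul, Finset.sum_mul, Finset.mul_sum, ← Finset.sum_add_distrib,
      ← Finset.sum_sub_distrib, sub_zero]
    refine Finset.sum_congr rfl fun x hx => ?_
    ring
  have hfin : (E ζ).re = ‖V ζ - conj (B ζ) * U ζ‖ ^ 2 + (1 - ‖B ζ‖ ^ 2) * ‖U ζ‖ ^ 2 := by
    rw [hEζ]
    simp only [← Complex.normSq_eq_norm_sq, Complex.normSq_apply, Complex.sub_re, Complex.add_re,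
      Complex.mul_re, Complex.mul_im, Complex.sub_im, Complex.conj_re, Complex.conj_im,
      Complex.re_ofNat, Complex.im_ofNat]
    ring
  show 0 ≤ (E ζ).re
  rw [hfin]
  have := hB1 ζ
  have h5 : 0 ≤ 1 - ‖B ζ‖ ^ 2 := by nlinarith [norm_nonneg (B ζ)]
  positivity

/-- The de Branges–Rovnyak kernel is positive semidefinite. -/
theorem dbrKernel_posSemidef {b : 𝔻 → ℂ} (hb : b ∈ hInftyUnitBall) :
    (dbrKernel b).PosSemidef := by
  have htfae := (RKHS.posSemidef_tfae (K := dbrKernel b)).out 0 2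
  refine htfae.mpr (And.intro ?_ fun vv => ?_)
  · ext z w
    simp [dbrKernel, Matrix.conjTranspose_apply, mul_comm]
  · have hB1 : ∀ z, ‖discExt b z‖ ≤ 1 := by
      intro z
      unfold discExt
      split_ifs with h
      · exact hb.2 _
      · simp
    have hev : ∀ᶠ r : ℝ in 𝓝[<] 1, 0 < r ∧ r < 1 ∧ ∀ w ∈ vv.support, ‖(w : ℂ)‖ < r := by
      have h1 : ∀ᶠ r : ℝ in 𝓝[<] 1, 0 < r :=
        (eventually_gt_nhds (by norm_num)).filter_mono nhdsWithin_le_nhds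
      have h2 : ∀ᶠ r : ℝ in 𝓝[<] 1, r < 1 := self_mem_nhdsWithin
      have h3 : ∀ᶠ r : ℝ in 𝓝[<] 1, ∀ w ∈ vv.support, ‖(w : ℂ)‖ < r :=
        (Filter.eventually_all_finset _).2 fun w _ =>
          (eventually_gt_nhds w.norm_lt_one).filter_mono nhdsWithin_le_nhds
      filter_upwards [h1, h2, h3] with r a b c using ⟨a, b, c⟩
    have hlim : Tendsto (fun r : ℝ => (∑ w ∈ vv.support, ∑ x ∈ vv.support, conj (vv w) * vv x *
        ((1 - conj (discExt b x) * discExt b w) *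
          ((r : ℂ) ^ 2 / ((r : ℂ) ^ 2 - conj (x : ℂ) * w)))).re) (𝓝[<] 1)
        (𝓝 (∑ w ∈ vv.support, ∑ x ∈ vv.support, conj (vv w) * vv x *
        ((1 - conj (discExt b x) * discExt b w) *
          (((1 : ℝ) : ℂ) ^ 2 / (((1 : ℝ) : ℂ) ^ 2 - conj (x : ℂ) * w)))).re) := by
      refine (Complex.continuous_re.tendsto _).comp ?_
      refine tendsto_finsetSum _ fun w _ => tendsto_finsetSum _ fun x _ => ?_
      refine Tendsto.const_mul _ (Tendsto.const_mul _ ?_)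
      have hc : Tendsto (fun r : ℝ => (r : ℂ) ^ 2) (𝓝[<] 1) (𝓝 (((1 : ℝ) : ℂ) ^ 2)) :=
        ((Complex.continuous_ofReal.pow 2).tendsto 1).mono_left nhdsWithin_le_nhds
      refine hc.div (hc.sub_const _) ?_
      intro h
      have h1 : ‖conj (x : ℂ) * w‖ = 1 := by rw [← sub_eq_zero.1 h]; simp
      rw [norm_mul, RCLike.norm_conj] at h1
      nlinarith [x.norm_lt_one, w.norm_lt_one, norm_nonneg (x : ℂ), norm_nonneg (w : ℂ)]
    have hpos := ge_of_tendsto hlim (hev.mono fun r hr =>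
      dbrKernel_aux (discExt b) hb.1 hB1 vv.support vv r hr.1 hr.2.1 hr.2.2)
    refine hpos.trans_eq ?_
    rw [Finset.sum_comm]
    simp only [Finsupp.sum]
    rw [← Complex.conj_re]
    simp only [map_sum, Complex.re_sum]
    refine Finset.sum_congr rfl fun x _ => Finset.sum_congr rfl fun w _ => ?_
    refine congrArg Complex.re ?_
    simp [dbrKernel, discExt_coe]
    ring

instance dbrKernel_fact (b : hInftyUnitBall) : Fact (dbrKernel (b : 𝔻 → ℂ)).PosSemidef :=
  ⟨dbrKernel_posSemidef b.2⟩

/-- The de Branges–Rovnyak space `H(b)`: the Hilbert space of functions on the disc with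
reproducing kernel `dbrKernel b`. -/
abbrev DeBrangesRovnyak (b : hInftyUnitBall) : Type :=
  RKHS.OfKernel (dbrKernel (b : 𝔻 → ℂ))

/-- The functions on the disc that belong to `H(b)`. -/
def dbrFunctions (b : hInftyUnitBall) : Set (𝔻 → ℂ) :=
  range fun F : DeBrangesRovnyak b => (F : 𝔻 → ℂ)

/-- `H^p` is compactly contained in `H(b)`: it is contained in `H(b)` and the closed unit ball
of `H^p` is relatively compact in the norm of `H(b)`. -/
def IsCompactlyContained (p : ℝ) (b : hInftyUnitBall) : Prop :=
  hardySpace p ⊆ dbrFunctions b ∧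
    IsCompact (closure {F : DeBrangesRovnyak b |
      (F : 𝔻 → ℂ) ∈ hardySpace p ∧ hardyNorm p F ≤ 1})

/-- Outer functions: `f(z) = c * exp (∫_𝕋 (ζ + z) / (ζ - z) * u(ζ) dm(ζ))` with `|c| = 1` and a
real-valued integrable `u` (the logarithm of the modulus of the boundary function). -/
def IsOuter (f : 𝔻 → ℂ) : Prop :=
  ∃ (c : ℂ) (u : ℂ → ℝ), ‖c‖ = 1 ∧ CircleIntegrable u 0 1 ∧
    ∀ z : 𝔻, f z =
      c * Complex.exp (Real.circleAverage (fun ζ => herglotzRieszKernel 0 z ζ * (u ζ : ℂ)) 0 1)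

/-- `a` is a Pythagorean mate of `b`: an outer function in the unit ball of `H^∞` with
`|a|² + |b|² = 1` almost everywhere on the unit circle, in the sense of radial limits.
(For bounded analytic `a`, `b` the radial limits of `a` and of `b` exist almost everywhere.) -/
def IsPythagoreanMate (a b : 𝔻 → ℂ) : Prop :=
  a ∈ hInftyUnitBall ∧ IsOuter a ∧
    ∀ᵐ θ : ℝ, Tendsto
      (fun r : ℝ => ‖discExt a (circleMap 0 r θ)‖ ^ 2 + ‖discExt b (circleMap 0 r θ)‖ ^ 2)
      (𝓝[<] 1) (𝓝 1)

end

/-!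
Put `φ = b / a` and `q = 2p / (p - 2)`. For combinations `g = ∑ c_w k_w` and
`v = ∑ c_w conj (b w) k_w` of Szegő kernels, `|a|² + |b|² = 1` on the circle gives
`‖∑ c_w k_b(w, ·)‖² = ‖g - b v‖₂² + ‖a v‖₂²`, so `H(b)` embeds isometrically in `H² ⊕ H²`.

If `φ ∈ H^q` and `f ∈ H^p`, then `f φ ∈ H²` by Hölder's inequality. Hence
`∑ conj (c_w) f(w) = ⟨f, g - b v⟩ + ⟨f conj φ, a v⟩` is bounded by a multiple of
`‖∑ c_w k_b(w, ·)‖`, that is, `f ∈ H(b)`.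

Conversely, if `H^p ⊆ H(b)`, the inclusion is bounded by the closed graph theorem. For `F ∈ H(b)`
the embedding yields `|⟨F, b y⟩| ≤ ‖F‖ ‖a y‖₂`, and since `a` is outer one can let `a y` tend to
any `s ∈ H²`: this gives `|⟨f, φ s⟩| ≤ C ‖f‖_p ‖s‖₂`. The bound is invariant under rotations of `φ`,
hence, by the maximum principle, it holds for the dilations `φ_t`. Multiplying `f` by powers of `z`
turns it into `‖f φ_t‖₂ ≤ C ‖f‖_p`, and choosing `|f|` close to `(1 + |φ_t|²) ^ (1 / (p - 2))`
bounds the means of `|φ|^q`.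

The inclusion is not compact because `z ^ n` tends to zero pointwise, while its norm in `H(b)` is at
least its norm in `H²`.
-/

noncomputable section

open Metric (ball sphere closedBall isOpen_ball)

section CircleAverage

variable {E : Type*} [NormedAddCommGroup E] [NormedSpace ℝ E] {f g h : ℂ → ℂ} {p r : ℝ}

theorem continuous_comp_circleMap {X : Type*} [TopologicalSpace X] {F : ℂ → X} (hr : 0 ≤ r)
    (hF : ContinuousOn F (sphere 0 r)) : Continuous fun θ => F (circleMap 0 r θ) :=
  hF.comp_continuous (continuous_circleMap 0 r) (circleMap_mem_sphere 0 hr)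

theorem norm_circleAverage_le (F : ℂ → E) (r : ℝ) :
    ‖Real.circleAverage F 0 r‖ ≤ Real.circleAverage (fun z => ‖F z‖) 0 r := by
  unfold Real.circleAverage
  rw [norm_smul, smul_eq_mul, Real.norm_of_nonneg (by positivity)]
  gcongr
  exact intervalIntegral.norm_integral_le_integral_norm Real.two_pi_pos.le

theorem circleAverage_congr_of_norm_eq {F G : ℂ → E} (hr : 0 ≤ r)
    (h : ∀ z, ‖z‖ = r → F z = G z) : Real.circleAverage F 0 r = Real.circleAverage G 0 r :=
  Real.circleAverage_congr_sphere fun z hz => h z (by simpa [abs_of_nonneg hr] using hz)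

theorem circleAverage_mono_of_continuousOn {F G : ℂ → ℝ} (hr : 0 ≤ r)
    (hF : ContinuousOn F (sphere 0 r)) (hG : ContinuousOn G (sphere 0 r))
    (h : ∀ z, ‖z‖ = r → F z ≤ G z) : Real.circleAverage F 0 r ≤ Real.circleAverage G 0 r :=
  Real.circleAverage_mono (hF.circleIntegrable hr) (hG.circleIntegrable hr) fun z hz =>
    h z (by simpa [abs_of_nonneg hr] using hz)

theorem tendsto_circleAverage_of_bounded {ι : Type*} {l : Filter ι} [l.IsCountablyGenerated]
    {F : ι → ℂ → E} {G : ℂ → E} {ρ : ι → ℝ} {M R : ℝ} (hρ : ∀ᶠ i in l, 0 ≤ ρ i)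
    (hF : ∀ᶠ i in l, ContinuousOn (F i) (sphere 0 (ρ i)))
    (hM : ∀ᶠ i in l, ∀ z, ‖z‖ = ρ i → ‖F i z‖ ≤ M)
    (hlim : ∀ᵐ θ : ℝ, Tendsto (fun i => F i (circleMap 0 (ρ i) θ)) l (𝓝 (G (circleMap 0 R θ)))) :
    Tendsto (fun i => Real.circleAverage (F i) 0 (ρ i)) l (𝓝 (Real.circleAverage G 0 R)) := by
  refine (intervalIntegral.tendsto_integral_filter_of_dominated_convergence (fun _ => M) ?_ ?_
    (by simp) (hlim.mono fun θ hθ _ => hθ)).const_smul _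
  · filter_upwards [hρ, hF] with i hi hFi
      using (continuous_comp_circleMap hi hFi).aestronglyMeasurable
  · filter_upwards [hρ, hM] with i hi hMi
    exact Eventually.of_forall fun θ _ => hMi _ (by simp [abs_of_nonneg hi])

theorem tendsto_circleAverage_of_bounded_of_forall {ι : Type*} {l : Filter ι}
    [l.IsCountablyGenerated] {F : ι → ℂ → E} {G : ℂ → E} {M : ℝ} (hr : 0 ≤ r)
    (hF : ∀ᶠ i in l, ContinuousOn (F i) (sphere 0 r))
    (hM : ∀ᶠ i in l, ∀ z, ‖z‖ = r → ‖F i z‖ ≤ M)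
    (hlim : ∀ z, ‖z‖ = r → Tendsto (fun i => F i z) l (𝓝 (G z))) :
    Tendsto (fun i => Real.circleAverage (F i) 0 r) l (𝓝 (Real.circleAverage G 0 r)) :=
  tendsto_circleAverage_of_bounded (Eventually.of_forall fun _ => hr) hF hM <|
    Eventually.of_forall fun _ => hlim _ (by simp [abs_of_nonneg hr])

theorem circleAverage_comp_mul_left_of_norm_eq_one (F : ℂ → E) {η : ℂ} (hη : ‖η‖ = 1) (r : ℝ) :
    Real.circleAverage (fun z => F (η * z)) 0 r = Real.circleAverage F 0 r := by
  obtain ⟨t, rfl⟩ := (Complex.norm_eq_one_iff η).1 hη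
  rw [Real.circleAverage_eq_integral_add (f := F) t, Real.circleAverage]
  congr 2
  ext θ
  congr 1
  simp only [circleMap, zero_add]
  push_cast
  rw [add_mul, Complex.exp_add]
  ring

theorem circleAverage_comp_ofReal_mul (F : ℂ → E) (t r : ℝ) :
    Real.circleAverage (fun z => F (t * z)) 0 r = Real.circleAverage F 0 (t * r) := by
  unfold Real.circleAverage
  congr 2
  ext θ
  simp [circleMap, mul_assoc]

theorem circleAverage_mul_le_rpow_mul_rpow {q : ℝ} (hpq : p.HolderConjugate q) {F G : ℂ → ℝ}
    (hr : 0 ≤ r) (hF : ContinuousOn F (sphere 0 r)) (hG : ContinuousOn G (sphere 0 r))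
    (hF0 : ∀ z, 0 ≤ F z) (hG0 : ∀ z, 0 ≤ G z) :
    Real.circleAverage (fun z => F z * G z) 0 r ≤
      Real.circleAverage (fun z => F z ^ p) 0 r ^ (1 / p) *
        Real.circleAverage (fun z => G z ^ q) 0 r ^ (1 / q) := by
  have memLp : ∀ {H : ℂ → ℝ} {s : ℝ}, ContinuousOn H (sphere 0 r) →
      MemLp (fun θ => H (circleMap 0 r θ)) (ENNReal.ofReal s)
        (volume.restrict (Ioc 0 (2 * Real.pi))) := by
    intro H s hH
    obtain ⟨M, hM⟩ := (isCompact_sphere (0 : ℂ) r).exists_bound_of_continuousOn hH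
    exact MemLp.of_bound (continuous_comp_circleMap hr hH).aestronglyMeasurable M
      (Eventually.of_forall fun θ => hM _ (circleMap_mem_sphere 0 hr θ))
  have holder := integral_mul_le_Lp_mul_Lq_of_nonneg hpq
    (μ := volume.restrict (Ioc 0 (2 * Real.pi)))
    (f := fun θ => F (circleMap 0 r θ)) (g := fun θ => G (circleMap 0 r θ))
    (Eventually.of_forall fun _ => hF0 _) (Eventually.of_forall fun _ => hG0 _)
    (memLp hF) (memLp hG)
  have integral_rpow_nonneg : ∀ {H : ℂ → ℝ} {s : ℝ}, (∀ z, 0 ≤ H z) →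
      0 ≤ ∫ θ in Ioc 0 (2 * Real.pi), H (circleMap 0 r θ) ^ s := fun hH =>
    integral_nonneg fun _ => Real.rpow_nonneg (hH _) _
  have hc : (0 : ℝ) ≤ (2 * Real.pi)⁻¹ := by positivity
  unfold Real.circleAverage
  simp only [intervalIntegral.integral_of_le Real.two_pi_pos.le, smul_eq_mul]
  rw [Real.mul_rpow hc (integral_rpow_nonneg hF0), Real.mul_rpow hc (integral_rpow_nonneg hG0),
    mul_mul_mul_comm, ← Real.rpow_add' hc (by simp [hpq.inv_add_inv_eq_one])]
  simp only [one_div, hpq.inv_add_inv_eq_one, Real.rpow_one] at holder ⊢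
  gcongr

theorem continuousOn_sphere_of_differentiableOn {S : ℝ} (hf : DifferentiableOn ℂ f (ball 0 S))
    (hr : r < S) : ContinuousOn f (sphere 0 r) :=
  hf.continuousOn.mono <| Metric.sphere_subset_closedBall.trans <|
    Metric.closedBall_subset_ball hr

theorem mul_conj_eq_sq_of_norm_eq {z : ℂ} (hz : ‖z‖ = r) : z * conj z = (r : ℂ) ^ 2 := by
  rw [Complex.mul_conj, Complex.normSq_eq_norm_sq, hz, Complex.ofReal_pow]

/-- The sesquilinear pairing `∫ f(rζ) conj (g(rζ)) dm(ζ)`. -/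
def circlePairing (f g : ℂ → ℂ) (r : ℝ) : ℂ :=
  Real.circleAverage (fun z => f z * conj (g z)) 0 r

/-- The squared quadratic mean `∫ |f(rζ)|² dm(ζ)`. -/
def circleNormSq (f : ℂ → ℂ) (r : ℝ) : ℝ :=
  Real.circleAverage (fun z => ‖f z‖ ^ 2) 0 r

theorem circleNormSq_nonneg (f : ℂ → ℂ) (r : ℝ) : 0 ≤ circleNormSq f r :=
  Real.circleAverage_nonneg_of_nonneg fun _ _ => by positivity

theorem circlePairing_self (hr : 0 ≤ r) (hf : ContinuousOn f (sphere 0 r)) :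
    circlePairing f f r = circleNormSq f r := by
  have hcomm := ContinuousLinearMap.circleAverage_comp_comm Complex.ofRealCLM
    (f := fun z => ‖f z‖ ^ 2) ((hf.norm.pow 2).circleIntegrable hr)
  have hself : (Complex.ofRealCLM ∘ fun z => ‖f z‖ ^ 2) = fun z => f z * conj (f z) := by
    ext z
    simp [Complex.mul_conj, Complex.normSq_eq_norm_sq]
  rwa [hself] at hcomm

theorem conj_circlePairing (hr : 0 ≤ r) (hf : ContinuousOn f (sphere 0 r))
    (hg : ContinuousOn g (sphere 0 r)) : conj (circlePairing f g r) = circlePairing g f r := by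
  have hcomm := ContinuousLinearMap.circleAverage_comp_comm (Complex.conjCLE : ℂ →L[ℝ] ℂ)
    ((hf.mul (Complex.continuous_conj.comp_continuousOn hg)).circleIntegrable hr)
  have hswap : ((Complex.conjCLE : ℂ →L[ℝ] ℂ) ∘ fun z => f z * conj (g z)) =
      fun z => g z * conj (f z) := by
    ext z
    simp [mul_comm]
  exact hcomm.symm.trans (congrArg (Real.circleAverage · 0 r) hswap)

theorem norm_circlePairing_le (hr : 0 ≤ r) (hf : ContinuousOn f (sphere 0 r))
    (hg : ContinuousOn g (sphere 0 r)) :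
    ‖circlePairing f g r‖ ≤ √(circleNormSq f r) * √(circleNormSq g r) := by
  refine (norm_circleAverage_le _ _).trans ?_
  simpa [circleNormSq, Real.sqrt_eq_rpow] using
    circleAverage_mul_le_rpow_mul_rpow Real.HolderConjugate.two_two hr hf.norm hg.norm
      (fun _ => norm_nonneg _) (fun _ => norm_nonneg _)

theorem circlePairing_sub_left (hr : 0 ≤ r) (hf : ContinuousOn f (sphere 0 r))
    (hg : ContinuousOn g (sphere 0 r)) (hh : ContinuousOn h (sphere 0 r)) :
    circlePairing (fun z => f z - g z) h r = circlePairing f h r - circlePairing g h r := by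
  have hc := Complex.continuous_conj.comp_continuousOn hh
  unfold circlePairing
  simp only [sub_mul]
  exact Real.circleAverage_fun_sub ((hf.mul hc).circleIntegrable hr)
    ((hg.mul hc).circleIntegrable hr)

theorem circlePairing_sub_right (hr : 0 ≤ r) (hf : ContinuousOn f (sphere 0 r))
    (hg : ContinuousOn g (sphere 0 r)) (hh : ContinuousOn h (sphere 0 r)) :
    circlePairing h (fun z => f z - g z) r = circlePairing h f r - circlePairing h g r := by
  rw [← conj_circlePairing hr (hf.fun_sub hg) hh, circlePairing_sub_left hr hf hg hh, map_sub,
    conj_circlePairing hr hf hh, conj_circlePairing hr hg hh]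

theorem circleNormSq_mono (hr : 0 ≤ r) (hf : ContinuousOn f (sphere 0 r))
    (hg : ContinuousOn g (sphere 0 r)) (h : ∀ z, ‖z‖ = r → ‖f z‖ ≤ ‖g z‖) :
    circleNormSq f r ≤ circleNormSq g r :=
  circleAverage_mono_of_continuousOn hr (hf.norm.pow 2) (hg.norm.pow 2) fun z hz =>
    pow_le_pow_left₀ (norm_nonneg _) (h z hz) 2

theorem circleNormSq_le_of_norm_le {M : ℝ} (hr : 0 ≤ r) (hf : ContinuousOn f (sphere 0 r))
    (h : ∀ z, ‖z‖ = r → ‖f z‖ ≤ M) : circleNormSq f r ≤ M ^ 2 :=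
  Real.circleAverage_mono_on_of_le_circle ((hf.norm.pow 2).circleIntegrable hr) fun z hz =>
    pow_le_pow_left₀ (norm_nonneg _) (h z (by simpa [abs_of_nonneg hr] using hz)) 2

end CircleAverage

section Dilation

variable {f y φ Q k : ℂ → ℂ} {r S : ℝ}

theorem differentiableOn_circleAverage_mul_comp {R : ℝ} (hr : 0 ≤ r) (hRS : R * r < S)
    (hQ : ContinuousOn Q (sphere 0 r)) (hk : ContinuousOn k (sphere 0 r))
    (hkr : ∀ z, ‖z‖ = r → ‖k z‖ ≤ r) (hφ : DifferentiableOn ℂ φ (ball 0 S)) :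
    DifferentiableOn ℂ (fun η => Real.circleAverage (fun z => Q z * φ (η * k z)) 0 r)
      (ball 0 R) := by
  intro η₀ hη₀
  have hkθ : ∀ θ : ℝ, ‖k (circleMap 0 r θ)‖ ≤ r := fun θ => hkr _ (by simp [abs_of_nonneg hr])
  have hmem : ∀ η ∈ ball (0 : ℂ) R, ∀ θ : ℝ, η * k (circleMap 0 r θ) ∈ closedBall 0 (R * r) := by
    intro η hη θ
    rw [mem_ball_zero_iff] at hη
    rw [mem_closedBall_zero_iff, norm_mul]
    exact mul_le_mul hη.le (hkθ θ) (norm_nonneg _) ((norm_nonneg η).trans hη.le)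
  have hsub : closedBall (0 : ℂ) (R * r) ⊆ ball 0 S := Metric.closedBall_subset_ball hRS
  have hφ' : DifferentiableOn ℂ (deriv φ) (ball 0 S) := hφ.deriv isOpen_ball
  obtain ⟨M, hM⟩ := (isCompact_closedBall (0 : ℂ) (R * r)).exists_bound_of_continuousOn
    (hφ'.continuousOn.mono hsub)
  obtain ⟨N, hN⟩ := (isCompact_sphere (0 : ℂ) r).exists_bound_of_continuousOn hQ
  have cQ := continuous_comp_circleMap hr hQ
  have ck := continuous_comp_circleMap hr hk
  have ccomp : ∀ {ψ : ℂ → ℂ}, DifferentiableOn ℂ ψ (ball 0 S) → ∀ η ∈ ball (0 : ℂ) R,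
      Continuous fun θ => ψ (η * k (circleMap 0 r θ)) := fun hψ η hη =>
    hψ.continuousOn.comp_continuous (ck.const_mul η) fun θ => hsub (hmem η hη θ)
  have hbound : ∀ θ : ℝ, ∀ η ∈ ball (0 : ℂ) R, ‖Q (circleMap 0 r θ) *
      (deriv φ (η * k (circleMap 0 r θ)) * k (circleMap 0 r θ))‖ ≤ N * (M * r) := by
    intro θ η hη
    have hNθ := hN _ (circleMap_mem_sphere 0 hr θ)
    have hMη := hM _ (hmem η hη θ)
    have := (norm_nonneg _).trans hMη
    rw [norm_mul, norm_mul]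
    exact mul_le_mul hNθ (mul_le_mul hMη (hkθ θ) (norm_nonneg _) this) (by positivity)
      ((norm_nonneg _).trans hNθ)
  have hderiv := intervalIntegral.hasDerivAt_integral_of_dominated_loc_of_deriv_le (𝕜 := ℂ)
    (μ := volume) (a := 0) (b := 2 * Real.pi) (isOpen_ball.mem_nhds hη₀)
    (eventually_of_mem (isOpen_ball.mem_nhds hη₀) fun η hη =>
      (cQ.mul (ccomp hφ η hη)).aestronglyMeasurable)
    ((cQ.mul (ccomp hφ η₀ hη₀)).intervalIntegrable _ _)
    (cQ.mul ((ccomp hφ' η₀ hη₀).mul ck)).aestronglyMeasurable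
    (Eventually.of_forall fun θ _ => hbound θ) intervalIntegrable_const
    (Eventually.of_forall fun θ _ η hη =>
      ((hφ.differentiableAt (isOpen_ball.mem_nhds (hsub (hmem η hη θ)))).hasDerivAt.comp η
        (hasDerivAt_mul_const _)).const_mul _)
  exact (hderiv.2.differentiableAt.const_smul (2 * Real.pi)⁻¹).differentiableWithinAt

theorem diffContOnCl_circleAverage_mul_comp (hr : 0 ≤ r) (hrS : r < S)
    (hQ : ContinuousOn Q (sphere 0 r)) (hk : ContinuousOn k (sphere 0 r))
    (hkr : ∀ z, ‖z‖ = r → ‖k z‖ ≤ r) (hφ : DifferentiableOn ℂ φ (ball 0 S)) :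
    DiffContOnCl ℂ (fun η => Real.circleAverage (fun z => Q z * φ (η * k z)) 0 r) (ball 0 1) := by
  obtain ⟨R, hRS, hR⟩ : ∃ R, R * r < S ∧ 1 < R :=
    (((continuous_mul_const r).tendsto' 1 r (one_mul r)).mono_left nhdsWithin_le_nhds
      |>.eventually_lt_const hrS).and (self_mem_nhdsWithin (s := Ioi (1 : ℝ))) |>.exists
  refine DifferentiableOn.diffContOnCl ?_
  rw [closure_ball _ one_ne_zero]
  exact (differentiableOn_circleAverage_mul_comp hr hRS hQ hk hkr hφ).mono
    (Metric.closedBall_subset_ball hR)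

theorem norm_circleAverage_mul_comp_le {C : ℝ} (hr : 0 ≤ r) (hrS : r < S)
    (hQ : ContinuousOn Q (sphere 0 r)) (hφ : DifferentiableOn ℂ φ (ball 0 S))
    (hC : ∀ η : ℂ, ‖η‖ = 1 → ‖Real.circleAverage (fun z => Q z * φ (η * z)) 0 r‖ ≤ C)
    {η : ℂ} (hη : ‖η‖ ≤ 1) : ‖Real.circleAverage (fun z => Q z * φ (η * z)) 0 r‖ ≤ C := by
  refine Complex.norm_le_of_forall_mem_frontier_norm_le Metric.isBounded_ball
    (diffContOnCl_circleAverage_mul_comp hr hrS hQ continuousOn_id (fun _ => le_of_eq) hφ)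
    (fun ξ hξ => hC ξ ?_) ?_
  · rwa [frontier_ball _ one_ne_zero, mem_sphere_zero_iff_norm] at hξ
  · rwa [closure_ball _ one_ne_zero, mem_closedBall_zero_iff]

theorem continuousOn_comp_mul_left_sphere (hrS : r < S) (hf : DifferentiableOn ℂ f (ball 0 S))
    {η : ℂ} (hη : ‖η‖ ≤ 1) : ContinuousOn (fun z => f (η * z)) (sphere 0 r) :=
  hf.continuousOn.comp (by fun_prop) fun z hz => by
    rw [mem_ball_zero_iff, norm_mul]
    exact (mul_le_of_le_one_left (norm_nonneg z) hη).trans_lt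
      ((mem_sphere_zero_iff_norm.1 hz).trans_lt hrS)

/-- Both sides are analytic in `η`, and for `‖η‖ = 1` they agree by rotation invariance. -/
theorem circlePairing_comp_conj_mul (hr : 0 ≤ r) (hrS : r < S)
    (hf : DifferentiableOn ℂ f (ball 0 S)) (hy : DifferentiableOn ℂ y (ball 0 S)) {η : ℂ}
    (hη : ‖η‖ ≤ 1) :
    circlePairing y (fun z => f (conj η * z)) r = circlePairing (fun z => y (η * z)) f r := by
  have hconj : ContinuousOn (conj : ℂ → ℂ) (sphere 0 r) := Complex.continuous_conj.continuousOn
  have hf' : DifferentiableOn ℂ (conj ∘ f ∘ conj) (ball 0 S) := fun z hz =>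
    (differentiableAt_conj_conj_iff.2 <| hf.differentiableAt <| isOpen_ball.mem_nhds <| by
      simpa using hz).differentiableWithinAt
  have hboundary : EqOn
      (fun η => Real.circleAverage (fun z => y z * (conj ∘ f ∘ conj) (η * conj z)) 0 r)
      (fun η => Real.circleAverage (fun z => conj (f z) * y (η * z)) 0 r)
      (frontier (ball 0 1)) := by
    intro ξ hξ
    rw [frontier_ball _ one_ne_zero, mem_sphere_zero_iff_norm] at hξ
    have hξξ : conj ξ * ξ = 1 := by simpa [mul_comm] using mul_conj_eq_sq_of_norm_eq hξ
    simp only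
    rw [← circleAverage_comp_mul_left_of_norm_eq_one _ hξ]
    refine congrArg (Real.circleAverage · 0 r) (funext fun z => ?_)
    simp only [Function.comp_apply, map_mul, Complex.conj_conj, ← mul_assoc, hξξ, one_mul]
    exact mul_comm _ _
  have heq := Complex.eqOn_closure_of_eqOn_frontier Metric.isBounded_ball
    (diffContOnCl_circleAverage_mul_comp hr hrS (continuousOn_sphere_of_differentiableOn hy hrS)
      hconj (fun z hz => by rw [RCLike.norm_conj, hz]) hf')
    (diffContOnCl_circleAverage_mul_comp hr hrS
      (Complex.continuous_conj.comp_continuousOn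
        (continuousOn_sphere_of_differentiableOn hf hrS))
      continuousOn_id (fun _ => le_of_eq) hy) hboundary
    (by rwa [closure_ball _ one_ne_zero, mem_closedBall_zero_iff] : η ∈ closure (ball 0 1))
  simpa [circlePairing, mul_comm] using heq

theorem circlePairing_eq_circlePairing_comp_mul {R : ℝ} (hr : 0 ≤ r) (hrR : r ≤ R) (hR : 0 < R)
    (hRS : R < S) (hf : DifferentiableOn ℂ f (ball 0 S)) (hy : DifferentiableOn ℂ y (ball 0 S)) :
    circlePairing f y r = circlePairing (fun z => f (((r / R) ^ 2 : ℝ) * z)) y R := by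
  have ht : ‖((r / R : ℝ) : ℂ)‖ ≤ 1 := by
    rw [Complex.norm_real, Real.norm_of_nonneg (by positivity)]
    exact (div_le_one hR).2 hrR
  have hfd : DifferentiableOn ℂ (fun z => f ((r / R : ℝ) * z)) (ball 0 S) :=
    hf.comp (by fun_prop) fun z hz => by
      rw [mem_ball_zero_iff, norm_mul]
      exact (mul_le_of_le_one_left (norm_nonneg z) ht).trans_lt (mem_ball_zero_iff.1 hz)
  calc circlePairing f y r
      = circlePairing (fun z => f ((r / R : ℝ) * z)) (fun z => y ((r / R : ℝ) * z)) R := by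
        rw [circlePairing, ← div_mul_cancel₀ r hR.ne', ← circleAverage_comp_ofReal_mul]
        simp only [div_mul_cancel₀ r hR.ne', circlePairing]
    _ = circlePairing (fun z => f (((r / R) ^ 2 : ℝ) * z)) y R := by
        have := circlePairing_comp_conj_mul hR.le hRS hy hfd ht
        rw [Complex.conj_ofReal] at this
        rw [this]
        simp only [← mul_assoc, ← pow_two, ← Complex.ofReal_pow]

theorem le_of_le_rpow_mul_rpow {X Y p q : ℝ} (hpq : p.HolderConjugate q) (hX : 0 ≤ X) (hY : 0 ≤ Y)
    (h : X ≤ X ^ (1 / q) * Y ^ (1 / p)) : X ≤ Y := by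
  obtain rfl | hX' := hX.eq_or_lt
  · exact hY
  refine (Real.rpow_le_rpow_iff hX hY (one_div_pos.2 hpq.pos)).1 ?_
  refine le_of_mul_le_mul_left ?_ (Real.rpow_pos_of_pos hX' (1 / q))
  rwa [← Real.rpow_add hX', one_div, one_div, hpq.symm.inv_add_inv_eq_one, Real.rpow_one,
    ← one_div, ← one_div]

theorem conj_mul_norm_rpow_sub_two_mul {p : ℝ} (hp : 2 ≤ p) (w : ℂ) :
    conj w * (‖w‖ ^ (p - 2) : ℝ) * w = (‖w‖ ^ p : ℝ) := by
  have hsq : w * conj w = (‖w‖ ^ (2 : ℝ) : ℝ) := by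
    rw [mul_conj_eq_sq_of_norm_eq rfl, Real.rpow_two, Complex.ofReal_pow]
  rw [mul_right_comm, mul_comm (conj w), hsq, ← Complex.ofReal_mul,
    ← Real.rpow_add_of_nonneg (norm_nonneg w) zero_le_two (by linarith), add_sub_cancel]

theorem norm_conj_mul_norm_rpow_sub_two {p : ℝ} (hp : 2 ≤ p) (w : ℂ) :
    ‖conj w * (‖w‖ ^ (p - 2) : ℝ)‖ ^ p.conjExponent = ‖w‖ ^ p := by
  rw [norm_mul, RCLike.norm_conj, Complex.norm_real, Real.norm_of_nonneg (by positivity),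
    ← Real.rpow_one_add' (norm_nonneg _) (by linarith), ← Real.rpow_mul (norm_nonneg _)]
  congr 1
  rw [Real.conjExponent]
  have : p - 1 ≠ 0 := by linarith
  field_simp
  ring

/-- Testing against `conj f |f|^(p - 2)` at the smaller radius reduces this to the maximum
principle. -/
theorem circleAverage_norm_rpow_le {p R : ℝ} (hp : 2 ≤ p) (hr : 0 ≤ r) (hrR : r ≤ R) (hR : 0 < R)
    (hRS : R < S) (hf : DifferentiableOn ℂ f (ball 0 S)) :
    Real.circleAverage (fun z => ‖f z‖ ^ p) 0 r ≤ Real.circleAverage (fun z => ‖f z‖ ^ p) 0 R := by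
  have hpq := Real.HolderConjugate.conjExponent (show 1 < p by linarith)
  have ht : ‖((r / R : ℝ) : ℂ)‖ ≤ 1 := by
    rw [Complex.norm_real, Real.norm_of_nonneg (by positivity)]
    exact (div_le_one hR).2 hrR
  set g : ℂ → ℂ := fun z => f ((r / R : ℝ) * z) with hg
  have hcg : ContinuousOn g (sphere 0 R) := continuousOn_comp_mul_left_sphere hRS hf ht
  set X := Real.circleAverage (fun z => ‖g z‖ ^ p) 0 R with hX
  set Y := Real.circleAverage (fun z => ‖f z‖ ^ p) 0 R
  have hX0 : 0 ≤ X := Real.circleAverage_nonneg_of_nonneg fun _ _ => by positivity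
  have hXr : Real.circleAverage (fun z => ‖f z‖ ^ p) 0 r = X := by
    rw [hX, hg, circleAverage_comp_ofReal_mul (fun z => ‖f z‖ ^ p), div_mul_cancel₀ r hR.ne']
  set Q : ℂ → ℂ := fun z => conj (g z) * (‖g z‖ ^ (p - 2) : ℝ)
  have hcQ : ContinuousOn Q (sphere 0 R) :=
    (Complex.continuous_conj.comp_continuousOn hcg).mul <|
      Complex.continuous_ofReal.comp_continuousOn <|
        hcg.norm.rpow_const fun _ _ => Or.inr (by linarith)
  have hboundary : ∀ η : ℂ, ‖η‖ = 1 → ‖Real.circleAverage (fun z => Q z * f (η * z)) 0 R‖ ≤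
      X ^ (1 / p.conjExponent) * Y ^ (1 / p) := by
    intro η hη
    refine (norm_circleAverage_le _ _).trans ?_
    have hholder := circleAverage_mul_le_rpow_mul_rpow hpq.symm hR.le hcQ.norm
      (continuousOn_comp_mul_left_sphere hRS hf hη.le).norm
      (fun _ => norm_nonneg _) (fun _ => norm_nonneg _)
    rw [circleAverage_comp_mul_left_of_norm_eq_one (fun z => ‖f z‖ ^ p) hη] at hholder
    simpa only [norm_mul (Q _), Q, norm_conj_mul_norm_rpow_sub_two hp] using hholder
  have htest : Real.circleAverage (fun z => Q z * f ((r / R : ℝ) * z)) 0 R = X := by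
    have hcomm := ContinuousLinearMap.circleAverage_comp_comm Complex.ofRealCLM
      (f := fun z => ‖g z‖ ^ p) <|
        (hcg.norm.rpow_const fun _ _ => Or.inr (by linarith)).circleIntegrable hR.le
    simp only [Function.comp_def, Complex.ofRealCLM_apply,
      ← conj_mul_norm_rpow_sub_two_mul hp] at hcomm
    exact hcomm
  have hle := norm_circleAverage_mul_comp_le hR.le hRS hcQ hf hboundary ht
  rw [htest, Complex.norm_real, Real.norm_of_nonneg hX0] at hle
  rw [hXr]
  exact le_of_le_rpow_mul_rpow hpq hX0
    (Real.circleAverage_nonneg_of_nonneg fun _ _ => by positivity) hle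

theorem circleNormSq_le_circleNormSq {R : ℝ} (hr : 0 ≤ r) (hrR : r ≤ R) (hR : 0 < R)
    (hRS : R < S) (hf : DifferentiableOn ℂ f (ball 0 S)) :
    circleNormSq f r ≤ circleNormSq f R := by
  unfold circleNormSq
  simpa only [Real.rpow_two] using circleAverage_norm_rpow_le le_rfl hr hrR hR hRS hf

end Dilation

section SzegoKernel

variable {y : ℂ → ℂ} {r : ℝ} {w z : ℂ}

/-- The Szegő kernel, that is, the reproducing kernel of the Hardy space `H²` at `w`. -/
def szegoKernel (w z : ℂ) : ℂ := 1 / (1 - conj w * z)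

theorem one_sub_conj_mul_ne_zero (hw : ‖w‖ < 1) (hz : ‖z‖ < 1) : 1 - conj w * z ≠ 0 := by
  refine sub_ne_zero.2 fun h => ?_
  have hnorm := congrArg norm h
  rw [norm_one, norm_mul, RCLike.norm_conj] at hnorm
  exact (mul_lt_one_of_nonneg_of_lt_one_left (norm_nonneg w) hw hz.le).ne' hnorm

theorem differentiableOn_szegoKernel (hw : ‖w‖ < 1) :
    DifferentiableOn ℂ (szegoKernel w) (ball 0 1) :=
  DifferentiableOn.div (by fun_prop) (by fun_prop) fun _ hz =>
    one_sub_conj_mul_ne_zero hw (mem_ball_zero_iff.1 hz)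

theorem norm_szegoKernel_le (hw : ‖w‖ < 1) (hz : ‖z‖ < 1) :
    ‖szegoKernel w z‖ ≤ 1 / (1 - ‖w‖) := by
  have hdenom : 1 - ‖w‖ ≤ ‖1 - conj w * z‖ := by
    have h := norm_sub_norm_le (1 : ℂ) (conj w * z)
    rw [norm_one, norm_mul, RCLike.norm_conj] at h
    nlinarith [norm_nonneg w]
  rw [szegoKernel, norm_div, norm_one]
  exact one_div_le_one_div_of_le (by linarith) hdenom

theorem circlePairing_szegoKernel (hr : r ∈ Ioo (0 : ℝ) 1) (hw : ‖w‖ < 1)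
    (hy : DifferentiableOn ℂ y (ball 0 1)) :
    circlePairing y (szegoKernel w) r = y (r ^ 2 * w) := by
  have hmem : ‖(r : ℂ) ^ 2 * w‖ < r := by
    rw [norm_mul, norm_pow, Complex.norm_real, Real.norm_of_nonneg hr.1.le]
    nlinarith [norm_nonneg w, mul_pos hr.1 hr.1, hr.1, hr.2]
  have hcauchy := DiffContOnCl.circleAverage_smul_div (R := r) (c := 0) (f := y)
    (w := (r : ℂ) ^ 2 * w)
    (by
      rw [abs_of_pos hr.1]
      exact hy.diffContOnCl_ball (Metric.closedBall_subset_ball hr.2))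
    (by rwa [abs_of_pos hr.1, mem_ball_zero_iff])
  rw [← hcauchy]
  refine circleAverage_congr_of_norm_eq hr.1.le fun z hz => ?_
  have hz0 : z ≠ 0 := norm_pos_iff.1 (hz ▸ hr.1)
  have hne : 1 - w * conj z ≠ 0 := by
    simpa using one_sub_conj_mul_ne_zero (w := conj w) (z := conj z) (by simpa using hw)
      (by simpa [hz] using hr.2)
  have hfactor : z - (r : ℂ) ^ 2 * w = z * (1 - w * conj z) := by
    rw [← mul_conj_eq_sq_of_norm_eq hz]
    ring
  rw [sub_zero, hfactor, szegoKernel]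
  simp only [map_div₀, map_one, map_sub, map_mul, Complex.conj_conj, smul_eq_mul]
  field_simp

/-- Finite linear combinations of Szegő kernels. -/
def szegoSum (s : Finset 𝔻) (c : 𝔻 → ℂ) (z : ℂ) : ℂ :=
  ∑ w ∈ s, c w * szegoKernel w z

variable (s : Finset 𝔻) (c : 𝔻 → ℂ)

theorem differentiableOn_szegoSum : DifferentiableOn ℂ (szegoSum s c) (ball 0 1) :=
  DifferentiableOn.fun_sum fun w _ => (differentiableOn_szegoKernel w.norm_lt_one).const_mul _

theorem exists_norm_szegoSum_le : ∃ M, ∀ z, ‖z‖ < 1 → ‖szegoSum s c z‖ ≤ M := by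
  refine ⟨∑ w ∈ s, ‖c w‖ * (1 / (1 - ‖(w : ℂ)‖)), fun z hz => norm_sum_le_of_le _ fun w _ => ?_⟩
  rw [norm_mul]
  gcongr
  exact norm_szegoKernel_le w.norm_lt_one hz

theorem circlePairing_szegoSum (hr : r ∈ Ioo (0 : ℝ) 1) (hy : DifferentiableOn ℂ y (ball 0 1)) :
    circlePairing y (szegoSum s c) r = ∑ w ∈ s, conj (c w) * y (r ^ 2 * w) := by
  have hexpand : (fun z => y z * conj (szegoSum s c z)) =
      fun z => ∑ w ∈ s, conj (c w) • (y z * conj (szegoKernel w z)) := by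
    ext z
    simp only [szegoSum, map_sum, map_mul, Finset.mul_sum, smul_eq_mul, mul_left_comm]
  rw [circlePairing, hexpand, Real.circleAverage_fun_sum fun w _ => ?_]
  · refine Finset.sum_congr rfl fun w _ => ?_
    rw [Real.circleAverage_fun_smul, smul_eq_mul]
    exact congrArg _ (circlePairing_szegoKernel hr w.norm_lt_one hy)
  · refine ContinuousOn.circleIntegrable hr.1.le (ContinuousOn.const_smul (c := conj (c w)) ?_)
    exact (continuousOn_sphere_of_differentiableOn hy hr.2).mul
      (Complex.continuous_conj.comp_continuousOn (continuousOn_sphere_of_differentiableOn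
        (differentiableOn_szegoKernel w.norm_lt_one) hr.2))

theorem tendsto_circlePairing_szegoSum (hy : DifferentiableOn ℂ y (ball 0 1)) :
    Tendsto (fun r => circlePairing y (szegoSum s c) r) (𝓝[<] 1)
      (𝓝 (∑ w ∈ s, conj (c w) * y w)) := by
  have hlim : Tendsto (fun r : ℝ => ∑ w ∈ s, conj (c w) * y ((r : ℂ) ^ 2 * w)) (𝓝[<] 1)
      (𝓝 (∑ w ∈ s, conj (c w) * y w)) := by
    refine tendsto_finsetSum _ fun w _ => Tendsto.const_mul _ ?_
    have hradial : Continuous fun r : ℝ => (r : ℂ) ^ 2 * w := by fun_prop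
    have hcont : ContinuousAt y w := (hy.differentiableAt
      (isOpen_ball.mem_nhds (mem_ball_zero_iff.2 w.norm_lt_one))).continuousAt
    exact hcont.tendsto.comp ((hradial.tendsto' 1 _ (by simp)).mono_left nhdsWithin_le_nhds)
  refine hlim.congr' ?_
  filter_upwards [Ioo_mem_nhdsLT one_pos] with r hr
  exact (circlePairing_szegoSum s c hr hy).symm

theorem tendsto_circlePairing_szegoSum_left (hy : DifferentiableOn ℂ y (ball 0 1)) :
    Tendsto (fun r => circlePairing (szegoSum s c) y r) (𝓝[<] 1)
      (𝓝 (conj (∑ w ∈ s, conj (c w) * y w))) := by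
  refine ((Complex.continuous_conj.tendsto _).comp
    (tendsto_circlePairing_szegoSum s c hy)).congr' ?_
  filter_upwards [Ioo_mem_nhdsLT one_pos] with r hr
  exact conj_circlePairing hr.1.le (continuousOn_sphere_of_differentiableOn hy hr.2)
    (continuousOn_sphere_of_differentiableOn (differentiableOn_szegoSum s c) hr.2)

end SzegoKernel

section Outer

variable {u v : ℂ → ℝ} {z : ℂ}

/-- The Herglotz integral of a real function on the unit circle: the analytic function in the disc
whose real part is the Poisson integral of `u`. -/
def herglotzIntegral (u : ℂ → ℝ) (z : ℂ) : ℂ :=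
  Real.circleAverage (fun ζ => herglotzRieszKernel 0 z ζ * (u ζ : ℂ)) 0 1

theorem circleIntegrable_ofReal {c : ℂ} {r : ℝ} (hu : CircleIntegrable u c r) :
    CircleIntegrable (fun ζ => (u ζ : ℂ)) c r := by
  simp only [CircleIntegrable, intervalIntegrable_iff] at hu ⊢
  exact Complex.ofRealCLM.integrable_comp hu

theorem circleIntegrable_max_const {c : ℂ} {r : ℝ} (hu : CircleIntegrable u c r) (t : ℝ) :
    CircleIntegrable (fun ζ => max (u ζ) t) c r := by
  have ht := circleIntegrable_const t c r
  simp only [CircleIntegrable, intervalIntegrable_iff] at hu ht ⊢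
  exact hu.sup ht

theorem circleIntegrable_herglotzRieszKernel_mul (hu : CircleIntegrable u 0 1) (hz : ‖z‖ < 1) :
    CircleIntegrable (fun ζ => herglotzRieszKernel 0 z ζ * (u ζ : ℂ)) 0 1 :=
  (circleIntegrable_ofReal hu).continuousOn_mul <| by
    simpa using continuousOn_herglotzRieszKernel_sphere (mem_ball_zero_iff.2 hz)

theorem differentiableOn_herglotzIntegral (hu : CircleIntegrable u 0 1) :
    DifferentiableOn ℂ (herglotzIntegral u) (ball 0 1) :=
  differentiableOn_circleAverage_herglotzRieszKernel_smul (circleIntegrable_ofReal hu)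

theorem herglotzIntegral_sub (hu : CircleIntegrable u 0 1) (hv : CircleIntegrable v 0 1)
    (hz : ‖z‖ < 1) :
    herglotzIntegral (fun ζ => u ζ - v ζ) z = herglotzIntegral u z - herglotzIntegral v z := by
  unfold herglotzIntegral
  rw [← Real.circleAverage_fun_sub (circleIntegrable_herglotzRieszKernel_mul hu hz)
    (circleIntegrable_herglotzRieszKernel_mul hv hz)]
  simp only [Complex.ofReal_sub, mul_sub]

theorem re_herglotzIntegral (hu : CircleIntegrable u 0 1) (hz : ‖z‖ < 1) :
    (herglotzIntegral u z).re =
      Real.circleAverage (fun ζ => (herglotzRieszKernel 0 z ζ).re * u ζ) 0 1 :=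
  re_circleAverage_herglotzRieszKernel_smul (R := 1) hu (by simpa using hz)

theorem re_herglotzIntegral_nonneg (hu : CircleIntegrable u 0 1) (hu0 : ∀ ζ, 0 ≤ u ζ)
    (hz : ‖z‖ < 1) : 0 ≤ (herglotzIntegral u z).re := by
  rw [re_herglotzIntegral hu hz]
  refine Real.circleAverage_nonneg_of_nonneg fun ζ hζ => mul_nonneg ?_ (hu0 ζ)
  refine le_trans ?_
    (le_re_herglotzRieszKernel (by simpa using hζ) (mem_ball_zero_iff.2 hz))
  rw [sub_zero]
  exact div_nonneg (sub_nonneg.2 hz.le) (by positivity)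

theorem re_herglotzIntegral_const (t : ℝ) (hz : ‖z‖ < 1) :
    (herglotzIntegral (fun _ => t) z).re = t := by
  rw [re_herglotzIntegral (circleIntegrable_const t 0 1) hz]
  exact InnerProductSpace.HarmonicOnNhd.circleAverage_re_herglotzRieszKernel_smul
    (fun x _ => InnerProductSpace.harmonicAt_const t) (by simpa using hz)

theorem le_re_herglotzIntegral {t : ℝ} (hu : CircleIntegrable u 0 1) (ht : ∀ ζ, t ≤ u ζ)
    (hz : ‖z‖ < 1) : t ≤ (herglotzIntegral u z).re := by
  have h := re_herglotzIntegral_nonneg (hu.sub (circleIntegrable_const t 0 1))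
    (fun ζ => sub_nonneg.2 (ht ζ)) hz
  rwa [Pi.sub_def, herglotzIntegral_sub hu (circleIntegrable_const t 0 1) hz, Complex.sub_re,
    re_herglotzIntegral_const t hz, sub_nonneg] at h

theorem tendsto_herglotzIntegral_max_sub (hu : CircleIntegrable u 0 1) (hz : ‖z‖ < 1) :
    Tendsto (fun n : ℕ => herglotzIntegral (fun ζ => max (u ζ) (-n) - u ζ) z) atTop (𝓝 0) := by
  have hint := circleIntegrable_herglotzRieszKernel_mul hu hz
  suffices h : Tendsto (fun n : ℕ => ∫ θ in (0 : ℝ)..2 * Real.pi,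
      herglotzRieszKernel 0 z (circleMap 0 1 θ) *
        ((max (u (circleMap 0 1 θ)) (-n) - u (circleMap 0 1 θ) : ℝ) : ℂ)) atTop
      (𝓝 (∫ _ in (0 : ℝ)..2 * Real.pi, (0 : ℂ))) by
    simpa [herglotzIntegral, Real.circleAverage] using h.const_smul (2 * Real.pi)⁻¹
  refine intervalIntegral.tendsto_integral_filter_of_dominated_convergence
    (fun θ => ‖herglotzRieszKernel 0 z (circleMap 0 1 θ) * (u (circleMap 0 1 θ) : ℂ)‖)
    (Eventually.of_forall fun n => ?_)
    (Eventually.of_forall fun n => Eventually.of_forall fun θ _ => ?_)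
    (IntervalIntegrable.norm hint) (Eventually.of_forall fun θ _ => ?_)
  · have hn := circleIntegrable_herglotzRieszKernel_mul
      ((circleIntegrable_max_const hu (-n)).sub hu) hz
    rw [CircleIntegrable, intervalIntegrable_iff] at hn
    exact hn.aestronglyMeasurable
  · rw [norm_mul, norm_mul, Complex.norm_real, Complex.norm_real, Real.norm_eq_abs,
      Real.norm_eq_abs]
    refine mul_le_mul_of_nonneg_left ?_ (norm_nonneg _)
    have : (0 : ℝ) ≤ n := n.cast_nonneg
    grind
  · obtain ⟨N, hN⟩ := exists_nat_ge (-u (circleMap 0 1 θ))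
    refine tendsto_const_nhds.congr' ?_
    filter_upwards [eventually_ge_atTop N] with n hn
    have hle : -(n : ℝ) ≤ u (circleMap 0 1 θ) :=
      neg_le.1 (hN.trans (by exact_mod_cast hn))
    simp [max_eq_left hle]

/-- The approximate inverses `conj c * exp (-H(max(u, -n)))` of the outer function
`c * exp (H(u))`, where `H` denotes the Herglotz integral. -/
def outerInverse (c : ℂ) (u : ℂ → ℝ) (n : ℕ) (z : ℂ) : ℂ :=
  conj c * Complex.exp (-herglotzIntegral (fun ζ => max (u ζ) (-n)) z)

theorem differentiableOn_outerInverse (c : ℂ) (hu : CircleIntegrable u 0 1) (n : ℕ) :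
    DifferentiableOn ℂ (outerInverse c u n) (ball 0 1) :=
  (differentiableOn_herglotzIntegral (circleIntegrable_max_const hu _)).neg.cexp.const_mul _

theorem norm_outerInverse_le {c : ℂ} (hc : ‖c‖ = 1) (hu : CircleIntegrable u 0 1) (n : ℕ)
    (hz : ‖z‖ < 1) : ‖outerInverse c u n z‖ ≤ Real.exp n := by
  rw [outerInverse, norm_mul, RCLike.norm_conj, hc, one_mul, Complex.norm_exp, Complex.neg_re]
  exact Real.exp_le_exp.2 <| neg_le.1 <|
    le_re_herglotzIntegral (circleIntegrable_max_const hu _) (fun _ => le_max_right _ _) hz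

theorem mul_outerInverse {c : ℂ} (hc : ‖c‖ = 1) (hu : CircleIntegrable u 0 1) (n : ℕ)
    (hz : ‖z‖ < 1) :
    c * Complex.exp (herglotzIntegral u z) * outerInverse c u n z =
      Complex.exp (-herglotzIntegral (fun ζ => max (u ζ) (-n) - u ζ) z) := by
  have hcc : c * conj c = 1 := by simp [mul_conj_eq_sq_of_norm_eq hc]
  rw [herglotzIntegral_sub (circleIntegrable_max_const hu _) hu hz, neg_sub, sub_eq_add_neg,
    Complex.exp_add, outerInverse, mul_mul_mul_comm, hcc, one_mul]

theorem IsOuter.exists_tendsto_mul_one {f : 𝔻 → ℂ} (hf : IsOuter f) :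
    ∃ g : ℕ → ℂ → ℂ, (∀ n, DifferentiableOn ℂ (g n) (ball 0 1)) ∧
      (∀ n, ∃ M, ∀ z, ‖z‖ < 1 → ‖g n z‖ ≤ M) ∧
      (∀ n z, ‖z‖ < 1 → ‖discExt f z * g n z‖ ≤ 1) ∧
      ∀ z, ‖z‖ < 1 → Tendsto (fun n => discExt f z * g n z) atTop (𝓝 1) := by
  obtain ⟨c, u, hc, hu, hfu⟩ := hf
  have hfg (n : ℕ) (z : ℂ) (hz : ‖z‖ < 1) : discExt f z * outerInverse c u n z =
      Complex.exp (-herglotzIntegral (fun ζ => max (u ζ) (-n) - u ζ) z) := by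
    rw [← mul_outerInverse hc hu n hz, discExt, dif_pos hz, hfu]
    rfl
  refine ⟨outerInverse c u, differentiableOn_outerInverse c hu,
    fun n => ⟨Real.exp n, fun z => norm_outerInverse_le hc hu n⟩, fun n z hz => ?_, fun z hz => ?_⟩
  · rw [hfg n z hz, Complex.norm_exp, Complex.neg_re, Real.exp_le_one_iff, neg_nonpos]
    exact re_herglotzIntegral_nonneg ((circleIntegrable_max_const hu _).sub hu)
      (fun ζ => sub_nonneg.2 (le_max_left _ _)) hz
  · simp only [hfg _ z hz]
    exact (Complex.continuous_exp.tendsto' _ _ (by simp)).comp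
      (tendsto_herglotzIntegral_max_sub hu hz).neg

end Outer

section PythagoreanPair

/-- A pair of analytic functions in the unit ball of `H^∞` with `|A|² + |B|² = 1` a.e. on the unit
circle, in the sense of radial limits. Compared with `IsPythagoreanMate`, the functions live on the
plane (their values outside the disc play no role beyond the bound) and `A` need not be outer. -/
structure IsPythagoreanPair (A B : ℂ → ℂ) : Prop where
  differentiableOn_left : DifferentiableOn ℂ A (ball 0 1)
  differentiableOn_right : DifferentiableOn ℂ B (ball 0 1)
  norm_left_le : ∀ z, ‖A z‖ ≤ 1
  norm_right_le : ∀ z, ‖B z‖ ≤ 1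
  radial : ∀ᵐ θ : ℝ, Tendsto
    (fun r : ℝ => ‖A (circleMap 0 r θ)‖ ^ 2 + ‖B (circleMap 0 r θ)‖ ^ 2) (𝓝[<] 1) (𝓝 1)

/-- The combination `∑ c_w k_B(w, ·)` of the kernels of `H(B)`, written as `g - B v` with `g` and
`v` combinations of Szegő kernels. -/
def kernelFun (B : ℂ → ℂ) (s : Finset 𝔻) (c : 𝔻 → ℂ) (z : ℂ) : ℂ :=
  szegoSum s c z - B z * szegoSum s (fun w => c w * conj (B w)) z

/-- The function `A v` associated with `kernelFun B s c = g - B v`. It complements the `H²`-norm of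
the latter to its norm in `H(B)`. -/
def companionFun (A B : ℂ → ℂ) (s : Finset 𝔻) (c : 𝔻 → ℂ) (z : ℂ) : ℂ :=
  A z * szegoSum s (fun w => c w * conj (B w)) z

variable {A B x y : ℂ → ℂ} {M N : ℝ} (s : Finset 𝔻) (c : 𝔻 → ℂ)

theorem differentiableOn_kernelFun (hB : DifferentiableOn ℂ B (ball 0 1)) :
    DifferentiableOn ℂ (kernelFun B s c) (ball 0 1) :=
  (differentiableOn_szegoSum _ _).sub (hB.mul (differentiableOn_szegoSum _ _))

theorem differentiableOn_companionFun (hA : DifferentiableOn ℂ A (ball 0 1)) :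
    DifferentiableOn ℂ (companionFun A B s c) (ball 0 1) :=
  hA.mul (differentiableOn_szegoSum _ _)

namespace IsPythagoreanPair

theorem abs_defect_le (h : IsPythagoreanPair A B) (z : ℂ) : |‖A z‖ ^ 2 + ‖B z‖ ^ 2 - 1| ≤ 1 := by
  have hA : ‖A z‖ ^ 2 ≤ 1 := pow_le_one₀ (norm_nonneg _) (h.norm_left_le z)
  have hB : ‖B z‖ ^ 2 ≤ 1 := pow_le_one₀ (norm_nonneg _) (h.norm_right_le z)
  rw [abs_le]
  constructor <;> linarith [sq_nonneg ‖A z‖, sq_nonneg ‖B z‖]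

theorem tendsto_circleAverage_defect_mul (h : IsPythagoreanPair A B)
    (hx : ContinuousOn x (ball 0 1)) (hM : ∀ z, ‖z‖ < 1 → ‖x z‖ ≤ M) :
    Tendsto (fun r => Real.circleAverage
      (fun z => ((‖A z‖ ^ 2 + ‖B z‖ ^ 2 - 1 : ℝ) : ℂ) * x z) 0 r) (𝓝[<] 1) (𝓝 0) := by
  have hr : ∀ᶠ r : ℝ in 𝓝[<] 1, r ∈ Ioo (0 : ℝ) 1 := Ioo_mem_nhdsLT one_pos
  suffices hlim : Tendsto (fun r => Real.circleAverage
      (fun z => ((‖A z‖ ^ 2 + ‖B z‖ ^ 2 - 1 : ℝ) : ℂ) * x z) 0 r) (𝓝[<] 1)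
      (𝓝 (Real.circleAverage (fun _ => (0 : ℂ)) 0 1)) by
    rwa [Real.circleAverage_const] at hlim
  refine tendsto_circleAverage_of_bounded (M := 1 * M) (hr.mono fun r hr => hr.1.le) ?_ ?_ ?_
  · filter_upwards [hr] with r hr
    have hdefect := ((continuousOn_sphere_of_differentiableOn h.differentiableOn_left
      hr.2).norm.pow 2).add ((continuousOn_sphere_of_differentiableOn h.differentiableOn_right
      hr.2).norm.pow 2) |>.sub (continuousOn_const (c := (1 : ℝ)))
    exact (Complex.continuous_ofReal.comp_continuousOn hdefect).mul <| hx.mono fun z hz =>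
      mem_ball_zero_iff.2 <| (mem_sphere_zero_iff_norm.1 hz).trans_lt hr.2
  · filter_upwards [hr] with r hr z hz
    rw [norm_mul, Complex.norm_real]
    exact mul_le_mul (h.abs_defect_le z) (hM z (hz.trans_lt hr.2)) (norm_nonneg _) zero_le_one
  · filter_upwards [h.radial] with θ hθ
    refine Tendsto.zero_mul_isBoundedUnder_le ?_ ⟨M, eventually_map.2 ?_⟩
    · exact (Complex.continuous_ofReal.tendsto' _ _ (by simp)).comp (hθ.sub_const 1)
    · filter_upwards [hr] with r hr
      exact hM _ (by simpa [abs_of_pos hr.1] using hr.2)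

theorem tendsto_circlePairing_mul_add_sub (h : IsPythagoreanPair A B)
    (hx : DifferentiableOn ℂ x (ball 0 1)) (hy : DifferentiableOn ℂ y (ball 0 1))
    (hM : ∀ z, ‖z‖ < 1 → ‖x z‖ ≤ M) (hN : ∀ z, ‖z‖ < 1 → ‖y z‖ ≤ N) :
    Tendsto (fun r => circlePairing (fun z => B z * x z) (fun z => B z * y z) r +
      circlePairing (fun z => A z * x z) (fun z => A z * y z) r - circlePairing x y r)
      (𝓝[<] 1) (𝓝 0) := by
  have hbound (z : ℂ) (hz : ‖z‖ < 1) : ‖x z * conj (y z)‖ ≤ M * N := by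
    rw [norm_mul, RCLike.norm_conj]
    exact mul_le_mul (hM z hz) (hN z hz) (norm_nonneg _) ((norm_nonneg _).trans (hM z hz))
  refine (h.tendsto_circleAverage_defect_mul (hx.continuousOn.mul
    (Complex.continuous_conj.comp_continuousOn hy.continuousOn)) hbound).congr' ?_
  filter_upwards [Ioo_mem_nhdsLT one_pos] with r hr
  have hint {f g : ℂ → ℂ} (hf : DifferentiableOn ℂ f (ball 0 1))
      (hg : DifferentiableOn ℂ g (ball 0 1)) :
      CircleIntegrable (fun z => f z * conj (g z)) 0 r :=
    ((continuousOn_sphere_of_differentiableOn hf hr.2).mul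
      (Complex.continuous_conj.comp_continuousOn
        (continuousOn_sphere_of_differentiableOn hg hr.2))).circleIntegrable hr.1.le
  have hA := h.differentiableOn_left
  have hB := h.differentiableOn_right
  have hBB := hint (hB.fun_mul hx) (hB.fun_mul hy)
  have hAA := hint (hA.fun_mul hx) (hA.fun_mul hy)
  unfold circlePairing
  rw [← Real.circleAverage_fun_add hBB hAA,
    ← Real.circleAverage_fun_sub (hBB.fun_add hAA) (hint hx hy)]
  congr 1
  ext z
  simp only [Pi.mul_apply, Function.comp_apply, Complex.ofReal_sub, Complex.ofReal_add,
    Complex.ofReal_one, ← Complex.normSq_eq_norm_sq, ← Complex.mul_conj, map_mul]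
  ring

theorem tendsto_circlePairing_kernelFun_mul (h : IsPythagoreanPair A B)
    (hy : DifferentiableOn ℂ y (ball 0 1)) (hN : ∀ z, ‖z‖ < 1 → ‖y z‖ ≤ N) :
    Tendsto (fun r => circlePairing (kernelFun B s c) (fun z => B z * y z) r -
      circlePairing (companionFun A B s c) (fun z => A z * y z) r) (𝓝[<] 1) (𝓝 0) := by
  set v := szegoSum s (fun w => c w * conj (B w))
  have hv : DifferentiableOn ℂ v (ball 0 1) := differentiableOn_szegoSum _ _
  have hB := h.differentiableOn_right
  obtain ⟨M, hM⟩ := exists_norm_szegoSum_le s (fun w => c w * conj (B w))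
  have hsum : ∑ w ∈ s, conj (c w * conj (B w)) * y w = ∑ w ∈ s, conj (c w) * (B w * y w) :=
    Finset.sum_congr rfl fun w _ => by simp [mul_assoc]
  have hg := tendsto_circlePairing_szegoSum_left s c (hB.fun_mul hy)
  have hlim := (hg.sub (tendsto_circlePairing_szegoSum_left s (fun w => c w * conj (B w)) hy)).sub
    (h.tendsto_circlePairing_mul_add_sub hv hy hM hN)
  rw [hsum, sub_self, sub_zero] at hlim
  refine hlim.congr' ?_
  filter_upwards [Ioo_mem_nhdsLT one_pos] with r hr
  have hsub : circlePairing (kernelFun B s c) (fun z => B z * y z) r =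
      circlePairing (szegoSum s c) (fun z => B z * y z) r -
        circlePairing (fun z => B z * v z) (fun z => B z * y z) r :=
    circlePairing_sub_left hr.1.le
      (continuousOn_sphere_of_differentiableOn (differentiableOn_szegoSum s c) hr.2)
      (continuousOn_sphere_of_differentiableOn (hB.fun_mul hv) hr.2)
      (continuousOn_sphere_of_differentiableOn (hB.fun_mul hy) hr.2)
  have hcompanion : companionFun A B s c = fun z => A z * v z := rfl
  rw [hsub, hcompanion]
  ring

theorem tendsto_circleNormSq_kernelFun (h : IsPythagoreanPair A B) :
    Tendsto (fun r =>
        ((circleNormSq (kernelFun B s c) r + circleNormSq (companionFun A B s c) r : ℝ) : ℂ))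
      (𝓝[<] 1) (𝓝 (∑ w ∈ s, conj (c w) * kernelFun B s c w)) := by
  set v := szegoSum s (fun w => c w * conj (B w))
  have hv : DifferentiableOn ℂ v (ball 0 1) := differentiableOn_szegoSum _ _
  have hK := differentiableOn_kernelFun s c h.differentiableOn_right
  obtain ⟨M, hM⟩ := exists_norm_szegoSum_le s (fun w => c w * conj (B w))
  have hlim := (tendsto_circlePairing_szegoSum s c hK).sub
    (h.tendsto_circlePairing_kernelFun_mul s c hv hM)
  rw [sub_zero] at hlim
  refine hlim.congr' ?_
  filter_upwards [Ioo_mem_nhdsLT one_pos] with r hr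
  have hKr := continuousOn_sphere_of_differentiableOn hK hr.2
  have hself : circlePairing (kernelFun B s c) (kernelFun B s c) r =
      circlePairing (kernelFun B s c) (szegoSum s c) r -
        circlePairing (kernelFun B s c) (fun z => B z * v z) r :=
    circlePairing_sub_right hr.1.le
      (continuousOn_sphere_of_differentiableOn (differentiableOn_szegoSum s c) hr.2)
      (continuousOn_sphere_of_differentiableOn (h.differentiableOn_right.fun_mul hv) hr.2) hKr
  have hcompanion := circlePairing_self hr.1.le (continuousOn_sphere_of_differentiableOn
    (differentiableOn_companionFun (B := B) s c h.differentiableOn_left) hr.2)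
  rw [Complex.ofReal_add, ← circlePairing_self hr.1.le hKr, hself, ← hcompanion, sub_sub_eq_add_sub,
    add_sub_right_comm]
  rfl

end IsPythagoreanPair

end PythagoreanPair

section DeBrangesRovnyak

theorem norm_discExt_le_of_norm_le {f : 𝔻 → ℂ} {M : ℝ} (hM : 0 ≤ M) (hf : ∀ z, ‖f z‖ ≤ M)
    (z : ℂ) : ‖discExt f z‖ ≤ M := by
  unfold discExt
  split_ifs
  · exact hf _
  · simpa

theorem discExt_comp_coe (f : ℂ → ℂ) {z : ℂ} (hz : ‖z‖ < 1) :
    discExt (fun w => f w) z = f z := by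
  rw [discExt, dif_pos hz, Complex.UnitDisc.coe_mk]

theorem discExt_sub (f g : 𝔻 → ℂ) (z : ℂ) : discExt (f - g) z = discExt f z - discExt g z := by
  unfold discExt
  split_ifs <;> simp

theorem differentiableOn_ball_of_tendstoUniformlyOn {F : ℕ → ℂ → ℂ} {f : ℂ → ℂ}
    (hF : ∀ n, DifferentiableOn ℂ (F n) (ball 0 1))
    (h : ∀ r < 1, TendstoUniformlyOn F f atTop (closedBall 0 r)) :
    DifferentiableOn ℂ f (ball 0 1) := by
  refine TendstoLocallyUniformlyOn.differentiableOn (F := F) (φ := atTop)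
    ((tendstoLocallyUniformlyOn_iff_forall_isCompact isOpen_ball).2 fun K hK hcompact => ?_)
    (Eventually.of_forall hF) isOpen_ball
  obtain ⟨r, hr, hKr⟩ := exists_lt_subset_ball hcompact.isClosed hK
  exact (h r hr).mono (hKr.trans Metric.ball_subset_closedBall)

section KernelSum

variable (b : hInftyUnitBall) (s : Finset 𝔻) (c : 𝔻 → ℂ)

/-- The finite linear combination `∑ c_w k_b(w, ·)` of the reproducing kernels of `H(b)`. -/
def kernelSum : DeBrangesRovnyak b :=
  ∑ w ∈ s, c w • RKHS.kerFun (DeBrangesRovnyak b) w 1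

theorem kerFun_one_apply (w z : 𝔻) :
    RKHS.kerFun (DeBrangesRovnyak b) w 1 z =
      (1 - conj ((b : 𝔻 → ℂ) w) * (b : 𝔻 → ℂ) z) / (1 - conj (w : ℂ) * (z : ℂ)) := by
  rw [RKHS.kerFun_apply, RKHS.OfKernel.kernel_ofKernel]
  simp [dbrKernel]

theorem kernelSum_apply (z : 𝔻) :
    kernelSum b s c z = kernelFun (discExt (b : 𝔻 → ℂ)) s c z := by
  rw [kernelSum, ← RKHS.coeCLM_apply, map_sum, Finset.sum_apply, kernelFun, szegoSum, szegoSum,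
    Finset.mul_sum, ← Finset.sum_sub_distrib]
  refine Finset.sum_congr rfl fun w _ => ?_
  rw [RKHS.coeCLM_apply, RKHS.coe_smul, Pi.smul_apply, smul_eq_mul, kerFun_one_apply, szegoKernel,
    discExt_coe, discExt_coe]
  ring

theorem discExt_kernelSum {z : ℂ} (hz : ‖z‖ < 1) :
    discExt (kernelSum b s c) z = kernelFun (discExt (b : 𝔻 → ℂ)) s c z := by
  rw [discExt, dif_pos hz, kernelSum_apply, Complex.UnitDisc.coe_mk]

theorem inner_kernelSum_left (F : DeBrangesRovnyak b) :
    inner ℂ (kernelSum b s c) F = ∑ w ∈ s, conj (c w) * F w := by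
  rw [kernelSum, sum_inner]
  refine Finset.sum_congr rfl fun w _ => ?_
  rw [inner_smul_left, RKHS.kerFun_inner]
  simp

theorem denseRange_linearCombination_kerFun : DenseRange
    (Finsupp.linearCombination ℂ fun w => RKHS.kerFun (DeBrangesRovnyak b) w 1) := by
  rw [DenseRange, ← LinearMap.coe_range, Finsupp.range_linearCombination,
    Submodule.dense_iff_topologicalClosure_eq_top, ← top_le_iff,
    ← RKHS.kerFun_dense (𝕜 := ℂ) (DeBrangesRovnyak b)]
  refine Submodule.topologicalClosure_mono (Submodule.span_le.2 ?_)
  rintro _ ⟨w, v, rfl⟩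
  rw [← mul_one v, ← smul_eq_mul, map_smul]
  exact Submodule.smul_mem _ _ (Submodule.subset_span (mem_range_self w))

variable {b}

theorem exists_norm_sub_kernelSum_lt (F : DeBrangesRovnyak b) {ε : ℝ} (hε : 0 < ε) :
    ∃ s c, ‖F - kernelSum b s c‖ < ε := by
  obtain ⟨c, hc⟩ := Metric.denseRange_iff.1 (denseRange_linearCombination_kerFun b) F ε hε
  exact ⟨c.support, c, by rwa [dist_eq_norm] at hc⟩

theorem exists_tendsto_kernelSum (F : DeBrangesRovnyak b) :
    ∃ (s : ℕ → Finset 𝔻) (c : ℕ → 𝔻 → ℂ),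
      Tendsto (fun n => kernelSum b (s n) (c n)) atTop (𝓝 F) := by
  choose s c h using fun n : ℕ =>
    exists_norm_sub_kernelSum_lt F (Nat.one_div_pos_of_nat (α := ℝ) (n := n))
  refine ⟨s, c, tendsto_iff_norm_sub_tendsto_zero.2 <| squeeze_zero (fun _ => norm_nonneg _)
    (fun n => ?_) tendsto_one_div_add_atTop_nhds_zero_nat⟩
  rw [norm_sub_rev]
  exact (h n).le

theorem mem_dbrFunctions_of_norm_sum_le {f : 𝔻 → ℂ} (C : ℝ)
    (hf : ∀ s c, ‖∑ w ∈ s, conj (c w) * f w‖ ≤ C * ‖kernelSum b s c‖) : f ∈ dbrFunctions b := by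
  set e : (𝔻 →₀ ℂ) →ₗ[ℂ] DeBrangesRovnyak b :=
    Finsupp.linearCombination ℂ fun w => RKHS.kerFun (DeBrangesRovnyak b) w 1 with he
  set l : (𝔻 →₀ ℂ) →ₗ[ℂ] ℂ := Finsupp.linearCombination ℂ fun w => conj (f w) with hl
  have hle (c : 𝔻 →₀ ℂ) : ‖l c‖ ≤ C * ‖e c‖ := by
    refine le_trans (le_of_eq ?_) (hf c.support c)
    rw [← RCLike.norm_conj, hl, Finsupp.linearCombination_apply, Finsupp.sum, map_sum]
    simp
  set F := (InnerProductSpace.toDual ℂ (DeBrangesRovnyak b)).symm (l.extendOfNorm e)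
  refine ⟨F, funext fun w => ?_⟩
  have hinner : inner ℂ F (RKHS.kerFun (DeBrangesRovnyak b) w 1) = conj (f w) := by
    rw [InnerProductSpace.toDual_symm_apply]
    simpa [he, hl] using LinearMap.extendOfNorm_eq (f := l)
      (denseRange_linearCombination_kerFun b) ⟨C, hle⟩ (Finsupp.single w 1)
  rw [RKHS.inner_kerFun] at hinner
  simpa using congrArg conj hinner

end KernelSum

section Analytic

variable {b : hInftyUnitBall} {r : ℝ}

theorem norm_discExt_le (F : DeBrangesRovnyak b) {z : ℂ} (hz : ‖z‖ ≤ r) (hr : r < 1) :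
    ‖discExt F z‖ ≤ ‖F‖ * √(2 / (1 - r)) := by
  set w := Complex.UnitDisc.mk z (hz.trans_lt hr)
  have hkernel : ‖RKHS.kernel (DeBrangesRovnyak b) w w‖ ≤ 2 / (1 - r) := by
    have hb := b.2.2 w
    have hnum : ‖1 - conj ((b : 𝔻 → ℂ) w) * (b : 𝔻 → ℂ) w‖ ≤ 2 := by
      refine (norm_sub_le _ _).trans ?_
      rw [norm_one, norm_mul, RCLike.norm_conj]
      nlinarith [norm_nonneg ((b : 𝔻 → ℂ) w)]
    have hden : 1 - r ≤ ‖1 - conj z * z‖ := by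
      have := norm_sub_norm_le (1 : ℂ) (conj z * z)
      rw [norm_one, norm_mul, RCLike.norm_conj] at this
      nlinarith [norm_nonneg z]
    have : 0 < 1 - r := sub_pos.2 hr
    rw [RKHS.OfKernel.kernel_ofKernel, dbrKernel, Matrix.of_apply, norm_smul, norm_one, mul_one,
      norm_div]
    exact div_le_div₀ zero_le_two hnum this hden
  rw [discExt, dif_pos (hz.trans_lt hr)]
  exact (RKHS.norm_apply_le F w).trans (by gcongr)

theorem tendstoUniformlyOn_discExt {F : DeBrangesRovnyak b} {G : ℕ → DeBrangesRovnyak b}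
    (hG : Tendsto G atTop (𝓝 F)) (hr : r < 1) :
    TendstoUniformlyOn (fun n => discExt (G n)) (discExt F) atTop (closedBall 0 r) := by
  have hlim := (tendsto_iff_norm_sub_tendsto_zero.1 hG).mul_const √(2 / (1 - r))
  rw [zero_mul] at hlim
  rw [Metric.tendstoUniformlyOn_iff]
  intro ε hε
  filter_upwards [hlim.eventually_lt_const hε] with n hn z hz
  rw [dist_comm, dist_eq_norm, ← discExt_sub, ← RKHS.coe_sub]
  exact (norm_discExt_le (G n - F) (mem_closedBall_zero_iff.1 hz) hr).trans_lt hn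

theorem isAnalyticOnDisc_coe (F : DeBrangesRovnyak b) : IsAnalyticOnDisc F := by
  obtain ⟨s, c, hsc⟩ := exists_tendsto_kernelSum F
  exact differentiableOn_ball_of_tendstoUniformlyOn (fun n =>
    (differentiableOn_kernelFun (s n) (c n) b.2.1).congr fun z hz =>
      discExt_kernelSum b _ _ (mem_ball_zero_iff.1 hz))
    fun r hr => tendstoUniformlyOn_discExt hsc hr

end Analytic

section Pair

variable {b : hInftyUnitBall} {A : ℂ → ℂ} {r : ℝ}

theorem tendsto_circleNormSq_norm_kernelSum (h : IsPythagoreanPair A (discExt (b : 𝔻 → ℂ)))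
    (s : Finset 𝔻) (c : 𝔻 → ℂ) :
    Tendsto (fun r => circleNormSq (kernelFun (discExt (b : 𝔻 → ℂ)) s c) r +
      circleNormSq (companionFun A (discExt (b : 𝔻 → ℂ)) s c) r)
      (𝓝[<] 1) (𝓝 (‖kernelSum b s c‖ ^ 2)) := by
  have hnorm : ∑ w ∈ s, conj (c w) * kernelFun (discExt (b : 𝔻 → ℂ)) s c w =
      ((‖kernelSum b s c‖ ^ 2 : ℝ) : ℂ) := by
    simp only [← kernelSum_apply, ← inner_kernelSum_left]
    exact (inner_self_eq_norm_sq_to_K _).trans (Complex.ofReal_pow _ _).symm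
  have hlim := h.tendsto_circleNormSq_kernelFun s c
  rw [hnorm] at hlim
  exact (Complex.continuous_re.tendsto _).comp hlim

theorem circleNormSq_kernelFun_le (h : IsPythagoreanPair A (discExt (b : 𝔻 → ℂ)))
    (s : Finset 𝔻) (c : 𝔻 → ℂ) (hr : r ∈ Ioo (0 : ℝ) 1) :
    circleNormSq (kernelFun (discExt (b : 𝔻 → ℂ)) s c) r ≤ ‖kernelSum b s c‖ ^ 2 := by
  refine ge_of_tendsto (tendsto_circleNormSq_norm_kernelSum h s c) ?_
  filter_upwards [Ioo_mem_nhdsLT hr.2] with R hR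
  exact (circleNormSq_le_circleNormSq hr.1.le hR.1.le (hr.1.trans hR.1) hR.2
    (differentiableOn_kernelFun s c b.2.1)).trans (le_add_of_nonneg_right (circleNormSq_nonneg _ _))

theorem circleNormSq_discExt_le (h : IsPythagoreanPair A (discExt (b : 𝔻 → ℂ)))
    (F : DeBrangesRovnyak b) (hr : r ∈ Ioo (0 : ℝ) 1) : circleNormSq (discExt F) r ≤ ‖F‖ ^ 2 := by
  obtain ⟨s, c, hsc⟩ := exists_tendsto_kernelSum F
  have hlim : Tendsto (fun n => circleNormSq (discExt (kernelSum b (s n) (c n))) r) atTop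
      (𝓝 (circleNormSq (discExt F) r)) := by
    refine tendsto_circleAverage_of_bounded_of_forall (M := ((‖F‖ + 1) * √(2 / (1 - r))) ^ 2)
      hr.1.le (Eventually.of_forall fun n => ?_) ?_ fun z hz => ?_
    · exact (continuousOn_sphere_of_differentiableOn (isAnalyticOnDisc_coe _) hr.2).norm.pow 2
    · filter_upwards [hsc.norm.eventually_le_const (lt_add_one ‖F‖)] with n hn z hz
      rw [norm_pow, norm_norm]
      gcongr
      exact (norm_discExt_le _ hz.le hr.2).trans (by gcongr)
    · exact ((tendstoUniformlyOn_discExt hsc hr.2).tendsto_at (by simp [hz])).norm.pow 2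
  refine le_of_tendsto_of_tendsto' hlim (hsc.norm.pow 2) fun n => ?_
  refine le_trans (le_of_eq ?_) (circleNormSq_kernelFun_le h (s n) (c n) hr)
  exact circleAverage_congr_of_norm_eq hr.1.le fun z hz => by
    rw [discExt_kernelSum b _ _ (hz.trans_lt hr.2)]

theorem eventually_norm_circlePairing_kernelFun_mul_le
    (h : IsPythagoreanPair A (discExt (b : 𝔻 → ℂ))) (s : Finset 𝔻) (c : 𝔻 → ℂ) {y : ℂ → ℂ}
    {N S ε : ℝ} (hy : DifferentiableOn ℂ y (ball 0 1)) (hyN : ∀ z, ‖z‖ < 1 → ‖y z‖ ≤ N)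
    (hS : ∀ r ∈ Ioo (0 : ℝ) 1, circleNormSq (fun z => A z * y z) r ≤ S) (hε : 0 < ε) :
    ∀ᶠ r in 𝓝[<] 1, ‖circlePairing (kernelFun (discExt (b : 𝔻 → ℂ)) s c)
      (fun z => discExt (b : 𝔻 → ℂ) z * y z) r‖ ≤ ‖kernelSum b s c‖ * √S + ε := by
  set K := kernelFun (discExt (b : 𝔻 → ℂ)) s c
  set L := companionFun A (discExt (b : 𝔻 → ℂ)) s c
  have hlim : Tendsto (fun r => ‖circlePairing K (fun z => discExt (b : 𝔻 → ℂ) z * y z) r -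
      circlePairing L (fun z => A z * y z) r‖ + √(circleNormSq K r + circleNormSq L r) * √S)
      (𝓝[<] 1) (𝓝 (‖(0 : ℂ)‖ + √(‖kernelSum b s c‖ ^ 2) * √S)) :=
    (h.tendsto_circlePairing_kernelFun_mul s c hy hyN).norm.add
      ((tendsto_circleNormSq_norm_kernelSum h s c).sqrt.mul_const _)
  rw [norm_zero, zero_add, Real.sqrt_sq (norm_nonneg _)] at hlim
  filter_upwards [hlim.eventually_le_const (lt_add_of_pos_right _ hε), Ioo_mem_nhdsLT one_pos]
    with r hrε hr
  refine le_trans ?_ hrε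
  rw [add_comm]
  refine (norm_le_norm_add_norm_sub' _ _).trans (add_le_add_left ?_ _)
  refine (norm_circlePairing_le hr.1.le (continuousOn_sphere_of_differentiableOn
    (differentiableOn_companionFun s c h.differentiableOn_left) hr.2)
    (continuousOn_sphere_of_differentiableOn (h.differentiableOn_left.fun_mul hy) hr.2)).trans ?_
  gcongr
  · exact le_add_of_nonneg_left (circleNormSq_nonneg _ _)
  · exact hS r hr

theorem norm_le_of_tendsto_circlePairing (h : IsPythagoreanPair A (discExt (b : 𝔻 → ℂ)))
    (F : DeBrangesRovnyak b) {y : ℂ → ℂ} {N S : ℝ} {l : ℂ}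
    (hy : DifferentiableOn ℂ y (ball 0 1)) (hyN : ∀ z, ‖z‖ < 1 → ‖y z‖ ≤ N)
    (hS : ∀ r ∈ Ioo (0 : ℝ) 1, circleNormSq (fun z => A z * y z) r ≤ S)
    (hl : Tendsto (fun r => circlePairing (discExt F) (fun z => discExt (b : 𝔻 → ℂ) z * y z) r)
      (𝓝[<] 1) (𝓝 l)) :
    ‖l‖ ≤ ‖F‖ * √S := by
  have hN : 0 ≤ N := (norm_nonneg _).trans (hyN 0 (by simp))
  have hby := h.differentiableOn_right.fun_mul hy
  have happrox (ε : ℝ) (hε : 0 < ε) : ‖l‖ ≤ ε * N + ((‖F‖ + ε) * √S + ε) := by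
    obtain ⟨s, c, hsc⟩ := exists_norm_sub_kernelSum_lt F hε
    set K := kernelSum b s c
    refine le_of_tendsto hl.norm ?_
    filter_upwards [eventually_norm_circlePairing_kernelFun_mul_le h s c hy hyN hS hε,
      Ioo_mem_nhdsLT one_pos] with r hK hr
    have hcont (G : DeBrangesRovnyak b) : ContinuousOn (discExt G) (sphere 0 r) :=
      continuousOn_sphere_of_differentiableOn (isAnalyticOnDisc_coe G) hr.2
    have hbyr := continuousOn_sphere_of_differentiableOn hby hr.2
    have hpairing : circlePairing (discExt F) (fun z => discExt (b : 𝔻 → ℂ) z * y z) r =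
        circlePairing (discExt ⇑(F - K)) (fun z => discExt (b : 𝔻 → ℂ) z * y z) r +
          circlePairing (kernelFun (discExt (b : 𝔻 → ℂ)) s c)
            (fun z => discExt (b : 𝔻 → ℂ) z * y z) r := by
      rw [← sub_eq_iff_eq_add, RKHS.coe_sub, funext (discExt_sub F K),
        circlePairing_sub_left hr.1.le (hcont F) (hcont K) hbyr]
      congr 1
      exact circleAverage_congr_of_norm_eq hr.1.le fun z hz => by
        rw [discExt_kernelSum b s c (hz.trans_lt hr.2)]
    rw [hpairing]
    refine (norm_add_le _ _).trans (add_le_add ?_ (hK.trans ?_))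
    · refine (norm_circlePairing_le hr.1.le (hcont _) hbyr).trans ?_
      gcongr
      · exact Real.sqrt_le_iff.2 ⟨hε.le, (circleNormSq_discExt_le h _ hr).trans (by gcongr)⟩
      · refine Real.sqrt_le_iff.2 ⟨hN, circleNormSq_le_of_norm_le hr.1.le hbyr fun z hz => ?_⟩
        rw [norm_mul]
        exact (mul_le_of_le_one_left (norm_nonneg _) (h.norm_right_le z)).trans
          (hyN z (hz.trans_lt hr.2))
    · gcongr
      exact (norm_le_norm_add_norm_sub _ _).trans (by gcongr)
  have hlim : Tendsto (fun ε : ℝ => ε * N + ((‖F‖ + ε) * √S + ε)) (𝓝[>] 0)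
      (𝓝 (0 * N + ((‖F‖ + 0) * √S + 0))) :=
    ((by fun_prop : Continuous fun ε : ℝ => ε * N + ((‖F‖ + ε) * √S + ε)).tendsto 0).mono_left
      nhdsWithin_le_nhds
  simpa using ge_of_tendsto hlim (eventually_mem_nhdsWithin.mono happrox)

/-- The two components of `⟨f, k⟩ = ⟨f, kernelFun⟩ + ⟨f conj φ, companionFun⟩`, where `A φ = b`,
are estimated by Cauchy's inequality. -/
theorem norm_circlePairing_szegoSum_le (h : IsPythagoreanPair A (discExt (b : 𝔻 → ℂ)))
    (s : Finset 𝔻) (c : 𝔻 → ℂ) {f φ : ℂ → ℂ} (hr : r ∈ Ioo (0 : ℝ) 1)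
    (hf : ContinuousOn f (sphere 0 r)) (hφ : ContinuousOn φ (sphere 0 r))
    (hAφ : ∀ z, ‖z‖ < 1 → A z * φ z = discExt (b : 𝔻 → ℂ) z) :
    ‖circlePairing f (szegoSum s c) r‖ ≤
      √(circleNormSq f r + circleNormSq (fun z => f z * φ z) r) *
        √(circleNormSq (kernelFun (discExt (b : 𝔻 → ℂ)) s c) r +
          circleNormSq (companionFun A (discExt (b : 𝔻 → ℂ)) s c) r) := by
  set v := szegoSum s (fun w => c w * conj (discExt (b : 𝔻 → ℂ) w))
  set K := kernelFun (discExt (b : 𝔻 → ℂ)) s c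
  set L := companionFun A (discExt (b : 𝔻 → ℂ)) s c
  have hv : DifferentiableOn ℂ v (ball 0 1) := differentiableOn_szegoSum _ _
  have hfφ : ContinuousOn (fun z => f z * conj (φ z)) (sphere 0 r) :=
    hf.mul (Complex.continuous_conj.comp_continuousOn hφ)
  have hsub : circlePairing f K r =
      circlePairing f (szegoSum s c) r - circlePairing f (fun z => discExt (b : 𝔻 → ℂ) z * v z) r :=
    circlePairing_sub_right hr.1.le
      (continuousOn_sphere_of_differentiableOn (differentiableOn_szegoSum s c) hr.2)
      (continuousOn_sphere_of_differentiableOn (h.differentiableOn_right.fun_mul hv) hr.2) hf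
  have hmove : circlePairing f (fun z => discExt (b : 𝔻 → ℂ) z * v z) r =
      circlePairing (fun z => f z * conj (φ z)) L r := by
    refine circleAverage_congr_of_norm_eq hr.1.le fun z hz => ?_
    simp only [L, companionFun, ← hAφ z (hz.trans_lt hr.2), map_mul, v]
    ring
  have hconj : circleNormSq (fun z => f z * conj (φ z)) r =
      circleNormSq (fun z => f z * φ z) r := by
    simp only [circleNormSq, norm_mul, RCLike.norm_conj]
  have hCauchy := Real.sum_sqrt_mul_sqrt_le (Finset.univ : Finset (Fin 2))
    (f := ![circleNormSq f r, circleNormSq (fun z => f z * φ z) r])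
    (g := ![circleNormSq K r, circleNormSq L r])
    (by simp [Fin.forall_fin_two, circleNormSq_nonneg])
    (by simp [Fin.forall_fin_two, circleNormSq_nonneg])
  simp only [Fin.sum_univ_two, Matrix.cons_val_zero, Matrix.cons_val_one] at hCauchy
  rw [sub_eq_iff_eq_add.1 hsub.symm, hmove]
  refine (norm_add_le _ _).trans
    ((add_le_add (norm_circlePairing_le hr.1.le hf ?_) ?_).trans hCauchy)
  · exact continuousOn_sphere_of_differentiableOn
      (differentiableOn_kernelFun s c h.differentiableOn_right) hr.2
  · rw [← hconj]
    exact norm_circlePairing_le hr.1.le hfφ (continuousOn_sphere_of_differentiableOn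
      (differentiableOn_companionFun s c h.differentiableOn_left) hr.2)

theorem mem_dbrFunctions_of_circleNormSq_le (h : IsPythagoreanPair A (discExt (b : 𝔻 → ℂ)))
    {f : 𝔻 → ℂ} {φ : ℂ → ℂ} {C : ℝ} (hf : IsAnalyticOnDisc f) (hφ : ContinuousOn φ (ball 0 1))
    (hAφ : ∀ z, ‖z‖ < 1 → A z * φ z = discExt (b : 𝔻 → ℂ) z)
    (hC : ∀ r ∈ Ioo (0 : ℝ) 1,
      circleNormSq (discExt f) r + circleNormSq (fun z => discExt f z * φ z) r ≤ C) :
    f ∈ dbrFunctions b := by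
  refine mem_dbrFunctions_of_norm_sum_le (√C) fun s c => ?_
  have hlim := (tendsto_circleNormSq_norm_kernelSum h s c).sqrt.const_mul (√C)
  rw [Real.sqrt_sq (norm_nonneg _)] at hlim
  have hpairing := (tendsto_circlePairing_szegoSum s c hf).norm
  simp only [discExt_coe] at hpairing
  refine le_of_tendsto_of_tendsto hpairing hlim ?_
  filter_upwards [Ioo_mem_nhdsLT one_pos] with r hr
  refine (norm_circlePairing_szegoSum_le h s c hr (continuousOn_sphere_of_differentiableOn hf hr.2)
    (hφ.mono fun z hz => ?_) hAφ).trans ?_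
  · simpa [mem_sphere_zero_iff_norm.1 hz] using hr.2
  · gcongr
    exact hC r hr

end Pair

end DeBrangesRovnyak

section ClosedGraph

open scoped lp in
/-- Closed graph theorem for the operator `c ↦ ∑ c_i f_i` from `ℓ¹` to `H`. -/
theorem exists_norm_le_of_forall_tsum_mem_range {ι X H : Type*} [NormedAddCommGroup H]
    [InnerProductSpace ℂ H] [CompleteSpace H] [RKHS ℂ H X ℂ] {f : ι → X → ℂ} {M : X → ℝ}
    (hM : ∀ i x, ‖f i x‖ ≤ M x)
    (hf : ∀ c : ℓ¹(ι, ℂ), (fun x => ∑' i, c i * f i x) ∈ range ((⇑) : H → X → ℂ)) :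
    ∃ C, ∀ (i : ι) (F : H), ⇑F = f i → ‖F‖ ≤ C := by
  classical
  let eval (x : X) : ℓ¹(ι, ℂ) →L[ℂ] ℂ := lp.tsumCLM ℂ ι ℂ ∘L
    lp.mapCLM 1 (fun i => ContinuousLinearMap.toSpanSingleton ℂ (f i x)) (abs_nonneg (M x))
      fun i => by
        rw [ContinuousLinearMap.norm_toSpanSingleton]
        exact (hM i x).trans (le_abs_self _)
  choose T hT using hf
  have hTeval (c : ℓ¹(ι, ℂ)) (x : X) : T c x = eval x c := by
    simp [hT, eval]
  let L : ℓ¹(ι, ℂ) →ₗ[ℂ] H :=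
    { toFun := T
      map_add' := fun c d => RKHS.ext (𝕜 := ℂ) fun x => by simp [hTeval]
      map_smul' := fun a c => RKHS.ext (𝕜 := ℂ) fun x => by simp [hTeval] }
  have hL : Continuous L := L.continuous_of_seq_closed_graph fun u c y hu hy =>
    RKHS.ext (𝕜 := ℂ) fun x => tendsto_nhds_unique
      (((RKHS.continuous_eval (𝕜 := ℂ) x).tendsto y).comp hy)
      (by
        simpa only [L, LinearMap.coe_mk, AddHom.coe_mk, hTeval, Function.comp_def] using
          ((eval x).continuous.tendsto c).comp hu)
  let Lc : ℓ¹(ι, ℂ) →L[ℂ] H := ⟨L, hL⟩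
  refine ⟨‖Lc‖, fun i F hF => ?_⟩
  have hsingle : Lc (lp.single 1 i (1 : ℂ)) = F := RKHS.ext (𝕜 := ℂ) fun x => by
    change T _ x = F x
    rw [hT, hF]
    dsimp only
    rw [tsum_eq_single i fun j hj => by simp [lp.single_apply, hj]]
    simp
  have hle := Lc.le_opNorm (lp.single 1 i (1 : ℂ))
  rwa [hsingle, lp.norm_single (by simp), norm_one, mul_one] at hle

theorem norm_le_mul_circleAverage_norm {f : ℂ → ℂ} {r R S : ℝ} (hr : 0 ≤ r) (hrR : r < R)
    (hRS : R < S) (hf : DifferentiableOn ℂ f (ball 0 S)) {z : ℂ} (hz : ‖z‖ ≤ r) :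
    ‖f z‖ ≤ R / (R - r) * Real.circleAverage (fun ζ => ‖f ζ‖) 0 R := by
  have hR : 0 < R := hr.trans_lt hrR
  have hcauchy := DiffContOnCl.circleAverage_smul_div (R := R) (c := 0) (f := f) (w := z)
    (by rw [abs_of_pos hR]; exact hf.diffContOnCl_ball (Metric.closedBall_subset_ball hRS))
    (by simpa [abs_of_pos hR] using hz.trans_lt hrR)
  have hsub (ζ : ℂ) (hζ : ‖ζ‖ = R) : R - r ≤ ‖ζ - z‖ := by
    linarith [norm_sub_norm_le ζ z]
  have hcf := continuousOn_sphere_of_differentiableOn hf hRS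
  have hck : ContinuousOn (fun ζ : ℂ => ((ζ - 0) / (ζ - z)) • f ζ) (sphere 0 R) := by
    have hne (ζ : ℂ) (hζ : ζ ∈ sphere 0 R) : ζ - z ≠ 0 := norm_pos_iff.1 <|
      (sub_pos.2 hrR).trans_le (hsub ζ (mem_sphere_zero_iff_norm.1 hζ))
    exact ((continuousOn_id.sub continuousOn_const).div
      (continuousOn_id.sub continuousOn_const) hne).smul hcf
  rw [← hcauchy, ← smul_eq_mul, ← Real.circleAverage_fun_smul]
  refine (norm_circleAverage_le _ _).trans
    (circleAverage_mono_of_continuousOn hR.le hck.norm (hcf.norm.fun_const_smul _) fun ζ hζ => ?_)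
  rw [sub_zero, norm_smul, norm_div, hζ, smul_eq_mul]
  have := sub_pos.2 hrR
  gcongr
  exact hsub ζ hζ

theorem rpow_sum_mul_le {ι : Type*} (s : Finset ι) {p : ℝ} (hp : 1 ≤ p) {w x : ι → ℝ}
    (hw : ∀ i, 0 ≤ w i) (hx : ∀ i, 0 ≤ x i) :
    (∑ i ∈ s, w i * x i) ^ p ≤ (∑ i ∈ s, w i) ^ (p - 1) * ∑ i ∈ s, w i * x i ^ p := by
  have hp0 : p ≠ 0 := by positivity
  have hw_sum : 0 ≤ ∑ i ∈ s, w i := Finset.sum_nonneg fun i _ => hw i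
  have hwx (i : ι) : 0 ≤ w i * x i ^ p := mul_nonneg (hw i) (Real.rpow_nonneg (hx i) _)
  have hwx_sum : 0 ≤ ∑ i ∈ s, w i * x i ^ p := Finset.sum_nonneg fun i _ => hwx i
  calc (∑ i ∈ s, w i * x i) ^ p
      ≤ ((∑ i ∈ s, w i) ^ (1 - p⁻¹) * (∑ i ∈ s, w i * x i ^ p) ^ p⁻¹) ^ p :=
        Real.rpow_le_rpow (Finset.sum_nonneg fun i _ => mul_nonneg (hw i) (hx i))
          (Real.inner_le_weight_mul_Lp_of_nonneg s hp w x hw hx) (by positivity)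
    _ = (∑ i ∈ s, w i) ^ (p - 1) * ∑ i ∈ s, w i * x i ^ p := by
        rw [Real.mul_rpow (by positivity) (by positivity), ← Real.rpow_mul hw_sum,
          Real.rpow_inv_rpow hwx_sum hp0, sub_mul, one_mul, inv_mul_cancel₀ hp0]

theorem circleAverage_norm_sum_rpow_le {ι : Type*} (s : Finset ι) (c : ι → ℂ) {F : ι → ℂ → ℂ}
    {p r : ℝ} (hp : 1 ≤ p) (hr : 0 ≤ r) (hF : ∀ i, ContinuousOn (F i) (sphere 0 r))
    (hF1 : ∀ i, Real.circleAverage (fun z => ‖F i z‖ ^ p) 0 r ≤ 1) :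
    Real.circleAverage (fun z => ‖∑ i ∈ s, c i * F i z‖ ^ p) 0 r ≤ (∑ i ∈ s, ‖c i‖) ^ p := by
  have hp0 : 0 < p := by positivity
  have hpow {G : ℂ → ℂ} (hG : ContinuousOn G (sphere 0 r)) :
      ContinuousOn (fun z => ‖G z‖ ^ p) (sphere 0 r) :=
    hG.norm.rpow_const fun _ _ => .inr hp0.le
  have hc (i : ι) : ContinuousOn (fun z => ‖c i‖ • ‖F i z‖ ^ p) (sphere 0 r) :=
    (hpow (hF i)).fun_const_smul _
  have hsum : 0 ≤ ∑ i ∈ s, ‖c i‖ := by positivity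
  calc Real.circleAverage (fun z => ‖∑ i ∈ s, c i * F i z‖ ^ p) 0 r
      ≤ Real.circleAverage
          (fun z => (∑ i ∈ s, ‖c i‖) ^ (p - 1) • ∑ i ∈ s, ‖c i‖ • ‖F i z‖ ^ p) 0 r := by
        refine circleAverage_mono_of_continuousOn hr
          (hpow (continuousOn_finsetSum _ fun i _ => continuousOn_const.mul (hF i)))
          ((continuousOn_finsetSum _ fun i _ => hc i).fun_const_smul _) fun z _ => ?_
        refine le_trans (Real.rpow_le_rpow (norm_nonneg _) (norm_sum_le _ _) hp0.le) ?_
        simp only [norm_mul]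
        exact rpow_sum_mul_le s hp (fun _ => norm_nonneg _) fun _ => norm_nonneg _
    _ = (∑ i ∈ s, ‖c i‖) ^ (p - 1) *
          ∑ i ∈ s, ‖c i‖ * Real.circleAverage (fun z => ‖F i z‖ ^ p) 0 r := by
        rw [Real.circleAverage_fun_smul,
          Real.circleAverage_fun_sum fun i _ => (hc i).circleIntegrable hr]
        simp_rw [Real.circleAverage_fun_smul, smul_eq_mul]
    _ ≤ (∑ i ∈ s, ‖c i‖) ^ (p - 1) * ∑ i ∈ s, ‖c i‖ := by
        gcongr with i
        exact mul_le_of_le_one_right (norm_nonneg _) (hF1 i)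
    _ = (∑ i ∈ s, ‖c i‖) ^ p := by
        rw [← Real.rpow_add_one' hsum (by simpa using hp0.ne'), sub_add_cancel]

/-- The closed unit ball of `H^p`, in terms of the means rather than of their supremum. -/
def hardyBall (p : ℝ) : Set (𝔻 → ℂ) :=
  {f | IsAnalyticOnDisc f ∧ ∀ r ∈ Ioo (0 : ℝ) 1, hardyMean p f r ≤ 1}

theorem hardyBall_subset_hardySpace (p : ℝ) : hardyBall p ⊆ hardySpace p := fun _ hf =>
  ⟨hf.1, 1, forall_mem_image.2 hf.2⟩

section HardyBall

variable {p : ℝ} (hp : 1 ≤ p)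
include hp

theorem norm_discExt_le_of_mem_hardyBall {f : 𝔻 → ℂ} (hf : f ∈ hardyBall p) {r : ℝ} (hr : r < 1)
    {z : ℂ} (hz : ‖z‖ ≤ r) : ‖discExt f z‖ ≤ (1 + r) / (1 - r) * 2 := by
  have hr0 : 0 ≤ r := (norm_nonneg z).trans hz
  obtain ⟨R, hRr⟩ : ∃ R, R = (1 + r) / 2 := ⟨_, rfl⟩
  have hrR : r < R := by linarith
  have hR : R ∈ Ioo (0 : ℝ) 1 := ⟨by linarith, by linarith⟩
  have hcont := continuousOn_sphere_of_differentiableOn hf.1 hR.2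
  have hpow : ContinuousOn (fun z => ‖discExt f z‖ ^ p) (sphere 0 R) :=
    hcont.norm.rpow_const fun _ _ => .inr (by positivity)
  have hmean : Real.circleAverage (fun ζ => ‖discExt f ζ‖) 0 R ≤ 2 := by
    calc Real.circleAverage (fun ζ => ‖discExt f ζ‖) 0 R
        ≤ Real.circleAverage (fun ζ => 1 + ‖discExt f ζ‖ ^ p) 0 R := by
          refine circleAverage_mono_of_continuousOn hR.1.le hcont.norm
            (continuousOn_const.add hpow) fun ζ _ => ?_
          rcases le_total ‖discExt f ζ‖ 1 with h | h
          · linarith [Real.rpow_nonneg (norm_nonneg (discExt f ζ)) p]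
          · linarith [Real.self_le_rpow_of_one_le h hp]
      _ = 1 + hardyMean p f R := by
          rw [Real.circleAverage_fun_add (circleIntegrable_const _ _ _)
            (hpow.circleIntegrable hR.1.le), Real.circleAverage_const, hardyMean]
      _ ≤ 2 := by linarith [hf.2 R hR]
  refine (norm_le_mul_circleAverage_norm hr0 hrR hR.2 hf.1 hz).trans ?_
  have : R / (R - r) = (1 + r) / (1 - r) := by
    rw [hRr, div_eq_div_iff (by linarith) (by linarith)]
    ring
  rw [this]
  have := sub_pos.2 hr
  gcongr

theorem tsum_mul_mem_hardySpace {f : ℕ → 𝔻 → ℂ} (hf : ∀ n, f n ∈ hardyBall p) {c : ℕ → ℂ}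
    (hc : Summable fun n => ‖c n‖) : (fun z => ∑' n, c n * f n z) ∈ hardySpace p := by
  have hbound {r : ℝ} (hr : r < 1) (n : ℕ) (z : ℂ) (hz : ‖z‖ ≤ r) :
      ‖c n * discExt (f n) z‖ ≤ ‖c n‖ * ((1 + r) / (1 - r) * 2) := by
    rw [norm_mul]
    gcongr
    exact norm_discExt_le_of_mem_hardyBall hp (hf n) hr hz
  have huniform (r : ℝ) (hr : r < 1) : TendstoUniformlyOn
      (fun n z => ∑ i ∈ Finset.range n, c i * discExt (f i) z)
      (discExt fun z => ∑' n, c n * f n z) atTop (closedBall 0 r) := by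
    refine (tendstoUniformlyOn_tsum_nat (hc.mul_right _) fun n z hz =>
      hbound hr n z (mem_closedBall_zero_iff.1 hz)).congr_right fun z hz => ?_
    simp [discExt, (mem_closedBall_zero_iff.1 hz).trans_lt hr]
  have hanalytic : IsAnalyticOnDisc fun z => ∑' n, c n * f n z :=
    differentiableOn_ball_of_tendstoUniformlyOn
      (fun n => .fun_sum fun i _ => (hf i).1.const_mul (c i)) huniform
  have hpartial (n : ℕ) : ∑ i ∈ Finset.range n, ‖c i‖ ≤ ∑' i, ‖c i‖ :=
    hc.sum_le_tsum _ fun _ _ => norm_nonneg _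
  refine ⟨hanalytic, (∑' n, ‖c n‖) ^ p, forall_mem_image.2 fun r hr => ?_⟩
  have hcont (i : ℕ) := continuousOn_sphere_of_differentiableOn (hf i).1 hr.2
  refine le_of_tendsto (x := atTop) (tendsto_circleAverage_of_bounded_of_forall hr.1.le
    (F := fun n z => ‖∑ i ∈ Finset.range n, c i * discExt (f i) z‖ ^ p)
    (M := ((∑' i, ‖c i‖) * ((1 + r) / (1 - r) * 2)) ^ p)
    (.of_forall fun n => ?_) (.of_forall fun n z hz => ?_) fun z hz => ?_)
    (.of_forall fun n => ?_)
  · exact (continuousOn_finsetSum _ fun i _ => continuousOn_const.mul (hcont i)).norm.rpow_const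
      fun _ _ => .inr (by positivity)
  · rw [Real.norm_of_nonneg (by positivity)]
    refine Real.rpow_le_rpow (norm_nonneg _) ?_ (by positivity)
    refine (norm_sum_le_of_le _ fun i _ => hbound hr.2 i z hz.le).trans ?_
    rw [← Finset.sum_mul]
    have := sub_pos.2 hr.2
    have := hr.1
    gcongr
    exact hpartial n
  · exact (((huniform r hr.2).tendsto_at (by simp [hz])).norm.rpow_const (.inr (by positivity)))
  · refine (circleAverage_norm_sum_rpow_le _ c hp hr.1.le hcont fun i => (hf i).2 r hr).trans ?_
    gcongr
    exact hpartial n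

theorem exists_norm_le_of_hardySpace_subset {b : hInftyUnitBall}
    (h : hardySpace p ⊆ dbrFunctions b) :
    ∃ C, ∀ F : DeBrangesRovnyak b, (F : 𝔻 → ℂ) ∈ hardyBall p → ‖F‖ ≤ C := by
  by_contra! hunbounded
  choose F hF hFn using fun n : ℕ => hunbounded (n : ℝ)
  obtain ⟨C, hC⟩ := exists_norm_le_of_forall_tsum_mem_range (H := DeBrangesRovnyak b)
    (f := fun n => F n) (M := fun z => (1 + ‖(z : ℂ)‖) / (1 - ‖(z : ℂ)‖) * 2)
    (fun n z => by
      simpa only [discExt_coe] using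
        norm_discExt_le_of_mem_hardyBall hp (hF n) z.norm_lt_one le_rfl)
    fun c => h (tsum_mul_mem_hardySpace hp hF (by simpa using (lp.memℓp c).summable (by simp)))
  obtain ⟨n, hn⟩ := exists_nat_gt C
  exact (hn.trans (hFn n)).not_ge (hC n (F n) rfl)

end HardyBall

end ClosedGraph

section PairingBound

theorem norm_ofReal_le_one {t : ℝ} (ht : t ∈ Ioo (0 : ℝ) 1) : ‖(t : ℂ)‖ ≤ 1 := by
  rw [Complex.norm_real, Real.norm_of_nonneg ht.1.le]
  exact ht.2.le

theorem differentiableOn_comp_ofReal_mul {f : ℂ → ℂ} (hf : DifferentiableOn ℂ f (ball 0 1)) {t : ℝ}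
    (ht : 0 < t) : DifferentiableOn ℂ (fun z => f (t * z)) (ball 0 (1 / t)) :=
  hf.comp (by fun_prop) fun z hz => by
    rw [mem_ball_zero_iff, lt_div_iff₀ ht] at hz
    rwa [mem_ball_zero_iff, norm_mul, Complex.norm_real, Real.norm_of_nonneg ht.le, mul_comm]

theorem exists_norm_le_of_differentiable {f : ℂ → ℂ} (hf : Differentiable ℂ f) (R : ℝ) :
    ∃ M, 0 ≤ M ∧ ∀ z, ‖z‖ ≤ R → ‖f z‖ ≤ M := by
  obtain ⟨M, hM⟩ := (isCompact_closedBall (0 : ℂ) R).exists_bound_of_continuousOn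
    hf.continuous.continuousOn
  exact ⟨max M 0, le_max_right _ _, fun z hz => (hM z (by simpa using hz)).trans (le_max_left _ _)⟩

theorem circlePairing_eq_circlePairing_comp_mul_of_differentiable {f y : ℂ → ℂ} {r R S : ℝ}
    (hf : Differentiable ℂ f) (hr : 0 < r) (hrR : r ≤ R) (hRS : R < S)
    (hy : DifferentiableOn ℂ y (ball 0 S)) :
    circlePairing f y R = circlePairing (fun z => f (((R / r) ^ 2 : ℝ) * z)) y r := by
  have hR : 0 < R := hr.trans_le hrR
  have hcancel : (r / R) ^ 2 * (R / r) ^ 2 = 1 := by field_simp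
  rw [circlePairing_eq_circlePairing_comp_mul (f := fun z => f (((R / r) ^ 2 : ℝ) * z)) hr.le hrR
    hR hRS (hf.comp (differentiable_id.const_mul _)).differentiableOn hy]
  congr! 2 with z
  rw [← mul_assoc, ← Complex.ofReal_mul, mul_comm ((R / r) ^ 2), hcancel, Complex.ofReal_one,
    one_mul]

theorem tendsto_circlePairing_of_differentiable {f y : ℂ → ℂ} (hf : Differentiable ℂ f)
    (hy : DifferentiableOn ℂ y (ball 0 1)) {ρ : ℝ} (hρ : ρ ∈ Ioo (0 : ℝ) 1) :
    Tendsto (circlePairing f y) (𝓝[<] 1)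
      (𝓝 (circlePairing (fun z => f (((1 / ρ) ^ 2 : ℝ) * z)) y ρ)) := by
  obtain ⟨M, hM0, hM⟩ := exists_norm_le_of_differentiable hf (1 / ρ)
  have hcy := continuousOn_sphere_of_differentiableOn hy hρ.2
  obtain ⟨N, hN⟩ := (isCompact_sphere (0 : ℂ) ρ).exists_bound_of_continuousOn hcy
  have hfixed : Tendsto (fun r : ℝ => circlePairing (fun z => f (((r / ρ) ^ 2 : ℝ) * z)) y ρ)
      (𝓝[<] 1) (𝓝 (circlePairing (fun z => f (((1 / ρ) ^ 2 : ℝ) * z)) y ρ)) := by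
    refine tendsto_circleAverage_of_bounded_of_forall (M := M * N) hρ.1.le
      (.of_forall fun r => ?_) ?_ fun z _ => ?_
    · exact (hf.continuous.comp (by fun_prop)).continuousOn.mul
        (Complex.continuous_conj.comp_continuousOn hcy)
    · filter_upwards [Ioo_mem_nhdsLT one_pos] with r hr z hz
      rw [norm_mul, RCLike.norm_conj]
      refine mul_le_mul (hM _ ?_) (hN z (mem_sphere_zero_iff_norm.2 hz)) (norm_nonneg _) hM0
      have : (r / ρ) ^ 2 * ρ = r ^ 2 / ρ := by field_simp [hρ.1.ne']
      rw [norm_mul, Complex.norm_real, Real.norm_of_nonneg (by positivity), hz, this]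
      have := hρ.1
      gcongr
      exact pow_le_one₀ hr.1.le hr.2.le
    · have hcont : Continuous fun r : ℝ => f (((r / ρ) ^ 2 : ℝ) * z) * conj (y z) :=
        (hf.continuous.comp (by fun_prop)).mul continuous_const
      exact (hcont.tendsto 1).mono_left nhdsWithin_le_nhds
  refine hfixed.congr' ?_
  filter_upwards [self_mem_nhdsWithin, (eventually_gt_nhds hρ.2).filter_mono nhdsWithin_le_nhds]
    with r hr hρr
  exact (circlePairing_eq_circlePairing_comp_mul_of_differentiable hf hρ.1 hρr.le hr hy).symm

/-- Boundedness of the form `⟨f, φ s⟩` with respect to the norms of `H^p` and `H²`, for entire `f`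
and `s`. Since `φ` need not extend to the unit circle, the form is evaluated on the circle of radius
`ρ < 1`, after the dilation of `f` that preserves pairings with analytic functions. -/
def HasPairingBound (p : ℝ) (φ : ℂ → ℂ) (C : ℝ) : Prop :=
  ∀ f s : ℂ → ℂ, Differentiable ℂ f → Differentiable ℂ s →
    Real.circleAverage (fun z => ‖f z‖ ^ p) 0 1 ≤ 1 → ∀ ρ ∈ Ioo (0 : ℝ) 1,
      ‖circlePairing (fun z => f (((1 / ρ) ^ 2 : ℝ) * z)) (fun z => φ z * s z) ρ‖ ≤
        C * √(circleNormSq s 1)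

theorem restrict_mem_hardyBall {p : ℝ} (hp : 2 ≤ p) {f : ℂ → ℂ} (hf : Differentiable ℂ f)
    (hf1 : Real.circleAverage (fun z => ‖f z‖ ^ p) 0 1 ≤ 1) :
    (fun z : 𝔻 => f z) ∈ hardyBall p := by
  refine ⟨hf.differentiableOn.congr fun z hz => discExt_comp_coe f (mem_ball_zero_iff.1 hz),
    fun r hr => ?_⟩
  calc hardyMean p (fun z : 𝔻 => f z) r
      = Real.circleAverage (fun z => ‖f z‖ ^ p) 0 r :=
        circleAverage_congr_of_norm_eq hr.1.le fun z hz => by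
          rw [discExt_comp_coe f (hz.trans_lt hr.2)]
    _ ≤ Real.circleAverage (fun z => ‖f z‖ ^ p) 0 1 :=
        circleAverage_norm_rpow_le hp hr.1.le hr.2.le one_pos one_lt_two hf.differentiableOn
    _ ≤ 1 := hf1

theorem norm_circlePairing_le_norm_mul_sqrt {A : ℂ → ℂ} {b : hInftyUnitBall}
    (h : IsPythagoreanPair A (discExt (b : 𝔻 → ℂ))) {F : DeBrangesRovnyak b} {f g s : ℂ → ℂ}
    (hf : Differentiable ℂ f) (hF : ∀ z : 𝔻, F z = f z)
    (hg : DifferentiableOn ℂ g (ball 0 1)) (hgb : ∃ M, ∀ z, ‖z‖ < 1 → ‖g z‖ ≤ M)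
    (hAg : ∀ z, ‖z‖ < 1 → ‖A z * g z‖ ≤ 1) (hs : Differentiable ℂ s) {ρ : ℝ}
    (hρ : ρ ∈ Ioo (0 : ℝ) 1) :
    ‖circlePairing (fun z => f (((1 / ρ) ^ 2 : ℝ) * z))
      (fun z => discExt (b : 𝔻 → ℂ) z * (g z * s z)) ρ‖ ≤ ‖F‖ * √(circleNormSq s 1) := by
  obtain ⟨M, hM⟩ := hgb
  obtain ⟨N, -, hN⟩ := exists_norm_le_of_differentiable hs 1
  have hM0 : 0 ≤ M := (norm_nonneg _).trans (hM 0 (by simp))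
  have hgs : DifferentiableOn ℂ (fun z => g z * s z) (ball 0 1) := hg.mul hs.differentiableOn
  have hlim := tendsto_circlePairing_of_differentiable hf
    (h.differentiableOn_right.fun_mul hgs) hρ
  refine norm_le_of_tendsto_circlePairing h F (N := M * N) hgs (fun z hz => ?_)
    (fun r hr => ?_) (hlim.congr' ?_)
  · rw [norm_mul]
    exact mul_le_mul (hM z hz) (hN z hz.le) (norm_nonneg _) hM0
  · refine (circleNormSq_mono hr.1.le
      (continuousOn_sphere_of_differentiableOn (h.differentiableOn_left.fun_mul hgs) hr.2)
      hs.continuous.continuousOn fun z hz => ?_).trans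
      (circleNormSq_le_circleNormSq hr.1.le hr.2.le one_pos one_lt_two hs.differentiableOn)
    rw [← mul_assoc, norm_mul]
    exact mul_le_of_le_one_left (norm_nonneg _) (hAg z (hz.trans_lt hr.2))
  · filter_upwards [Ioo_mem_nhdsLT one_pos] with r hr
    refine circleAverage_congr_of_norm_eq hr.1.le fun z hz => ?_
    have : discExt F z = f z := by simp [discExt, hz.trans_lt hr.2, hF]
    rw [this]

theorem tendsto_circlePairing_mul_right {f g : ℂ → ℂ} {u : ℕ → ℂ → ℂ} {r : ℝ} (hr : 0 ≤ r)
    (hf : ContinuousOn f (sphere 0 r)) (hg : ContinuousOn g (sphere 0 r))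
    (hu : ∀ n, ContinuousOn (u n) (sphere 0 r)) (hu1 : ∀ n z, ‖z‖ = r → ‖u n z‖ ≤ 1)
    (hlim : ∀ z, ‖z‖ = r → Tendsto (u · z) atTop (𝓝 1)) :
    Tendsto (fun n => circlePairing f (fun z => u n z * g z) r) atTop
      (𝓝 (circlePairing f g r)) := by
  obtain ⟨M, hM⟩ := (isCompact_sphere (0 : ℂ) r).exists_bound_of_continuousOn (hf.mul hg)
  refine tendsto_circleAverage_of_bounded_of_forall (M := M) hr
    (.of_forall fun n => hf.mul (Complex.continuous_conj.comp_continuousOn ((hu n).mul hg)))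
    (.of_forall fun n z hz => ?_) fun z hz => ?_
  · rw [norm_mul, RCLike.norm_conj, norm_mul]
    calc ‖f z‖ * (‖u n z‖ * ‖g z‖) ≤ ‖f z‖ * ‖g z‖ := by
          gcongr
          exact mul_le_of_le_one_left (norm_nonneg _) (hu1 n z hz)
      _ = ‖f z * g z‖ := (norm_mul _ _).symm
      _ ≤ M := hM z (mem_sphere_zero_iff_norm.2 hz)
  · refine ((Complex.continuous_conj.tendsto _).comp ?_).const_mul _
    simpa only [one_mul] using (hlim z hz).mul_const (g z)

theorem exists_hasPairingBound {b : hInftyUnitBall} {a : 𝔻 → ℂ} {p : ℝ} (hp : 2 ≤ p)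
    (h : IsPythagoreanPair (discExt a) (discExt (b : 𝔻 → ℂ))) (ha : IsOuter a)
    (hsub : hardySpace p ⊆ dbrFunctions b) {φ : ℂ → ℂ} (hφ : DifferentiableOn ℂ φ (ball 0 1))
    (haφ : ∀ z, ‖z‖ < 1 → discExt a z * φ z = discExt (b : 𝔻 → ℂ) z) :
    ∃ C, HasPairingBound p φ C := by
  obtain ⟨C, hC⟩ := exists_norm_le_of_hardySpace_subset (by linarith) hsub
  obtain ⟨g, hg, hgb, hag, hglim⟩ := ha.exists_tendsto_mul_one
  refine ⟨C, fun f s hf hs hf1 ρ hρ => ?_⟩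
  have hf_mem := restrict_mem_hardyBall hp hf hf1
  obtain ⟨F, hF : (F : 𝔻 → ℂ) = fun z : 𝔻 => f z⟩ :=
    hsub (hardyBall_subset_hardySpace p hf_mem)
  have hFC : ‖F‖ ≤ C := hC F (hF.symm ▸ hf_mem)
  have hcont {u : ℂ → ℂ} (hu : DifferentiableOn ℂ u (ball 0 1)) :=
    continuousOn_sphere_of_differentiableOn hu hρ.2
  have hlim := tendsto_circlePairing_mul_right hρ.1.le
    (hf.continuous.comp (continuous_const.mul continuous_id)).continuousOn
    (hcont (hφ.fun_mul hs.differentiableOn))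
    (fun n => hcont (h.differentiableOn_left.fun_mul (hg n)))
    (fun n z hz => hag n z (hz.trans_lt hρ.2)) (fun z hz => hglim z (hz.trans_lt hρ.2))
    (f := fun z => f (((1 / ρ) ^ 2 : ℝ) * z))
  refine le_of_tendsto hlim.norm (.of_forall fun n => ?_)
  calc _ = ‖circlePairing (fun z => f (((1 / ρ) ^ 2 : ℝ) * z))
          (fun z => discExt (b : 𝔻 → ℂ) z * (g n z * s z)) ρ‖ := by
        congr 1
        refine circleAverage_congr_of_norm_eq hρ.1.le fun z hz => ?_
        simp only [← haφ z (hz.trans_lt hρ.2)]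
        ring_nf
    _ ≤ ‖F‖ * √(circleNormSq s 1) :=
        norm_circlePairing_le_norm_mul_sqrt h hf (fun z => congrFun hF z) (hg n) (hgb n) (hag n)
          hs hρ
    _ ≤ C * √(circleNormSq s 1) := by gcongr

theorem HasPairingBound.norm_circlePairing_rotation_le {p C : ℝ} {φ f s : ℂ → ℂ}
    (h : HasPairingBound p φ C) (hf : Differentiable ℂ f) (hs : Differentiable ℂ s)
    (hf1 : Real.circleAverage (fun z => ‖f z‖ ^ p) 0 1 ≤ 1) {ρ : ℝ} (hρ : ρ ∈ Ioo (0 : ℝ) 1) {η : ℂ}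
    (hη : ‖η‖ = 1) :
    ‖circlePairing (fun z => f (((1 / ρ) ^ 2 : ℝ) * z)) (fun z => φ (η * z) * s z) ρ‖ ≤
      C * √(circleNormSq s 1) := by
  have hηη : conj η * η = 1 := by rw [mul_comm, mul_conj_eq_sq_of_norm_eq hη]; simp
  have hη' : ‖conj η‖ = 1 := by rw [RCLike.norm_conj, hη]
  have hrot {u : ℂ → ℂ} (hu : Differentiable ℂ u) : Differentiable ℂ fun z => u (conj η * z) :=
    hu.comp (differentiable_id.const_mul _)
  have hbound := h _ _ (hrot hf) (hrot hs)
    ((circleAverage_comp_mul_left_of_norm_eq_one (fun z => ‖f z‖ ^ p) hη' 1).trans_le hf1) ρ hρ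
  rw [circleNormSq, circleAverage_comp_mul_left_of_norm_eq_one (fun z => ‖s z‖ ^ 2) hη',
    circlePairing, ← circleAverage_comp_mul_left_of_norm_eq_one _ hη] at hbound
  refine (congrArg norm (circleAverage_congr_of_norm_eq hρ.1.le fun z _ => ?_)).trans_le hbound
  have hf_arg : conj η * (((1 / ρ) ^ 2 : ℝ) * (η * z)) = ((1 / ρ) ^ 2 : ℝ) * z := by
    linear_combination (((1 / ρ) ^ 2 : ℝ) : ℂ) * z * hηη
  have hs_arg : conj η * (η * z) = z := by linear_combination z * hηη
  simp only [hf_arg, hs_arg]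

/-- The form is analytic in the dilation parameter, so the maximum principle reduces a parameter in
the disc to unimodular ones. -/
theorem HasPairingBound.norm_circlePairing_dilation_le {p C : ℝ} {φ : ℂ → ℂ}
    (h : HasPairingBound p φ C) (hφ : DifferentiableOn ℂ φ (ball 0 1)) {t : ℝ}
    (ht : t ∈ Ioo (0 : ℝ) 1) {f s : ℂ → ℂ} (hf : Differentiable ℂ f) (hs : Differentiable ℂ s)
    (hf1 : Real.circleAverage (fun z => ‖f z‖ ^ p) 0 1 ≤ 1) :
    ‖circlePairing f (fun z => φ (t * z) * s z) 1‖ ≤ C * √(circleNormSq s 1) := by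
  obtain ⟨ρ, hρ⟩ : ∃ ρ, ρ ∈ Ioo (0 : ℝ) 1 := ⟨1 / 2, by norm_num⟩
  set F : ℂ → ℂ := fun z => f (((1 / ρ) ^ 2 : ℝ) * z)
  have hcF : Continuous F := hf.continuous.comp (continuous_const.mul continuous_id)
  have hpairing (η : ℂ) (hη : ‖η‖ ≤ 1) :
      ‖Real.circleAverage (fun z => conj (F z) * s z * φ (η * z)) 0 ρ‖ =
        ‖circlePairing F (fun z => φ (η * z) * s z) ρ‖ := by
    rw [← RCLike.norm_conj (circlePairing _ _ _), conj_circlePairing hρ.1.le hcF.continuousOn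
      ((continuousOn_comp_mul_left_sphere hρ.2 hφ hη).fun_mul hs.continuous.continuousOn)]
    exact congrArg norm (circleAverage_congr_of_norm_eq hρ.1.le fun z _ => by ring)
  have ht1 := norm_ofReal_le_one ht
  rw [circlePairing_eq_circlePairing_comp_mul_of_differentiable hf hρ.1 hρ.2.le
    ((one_lt_div ht.1).2 ht.2)
    ((differentiableOn_comp_ofReal_mul hφ ht.1).fun_mul hs.differentiableOn), ← hpairing _ ht1]
  refine norm_circleAverage_mul_comp_le hρ.1.le hρ.2
    ((Complex.continuous_conj.comp hcF).fun_mul hs.continuous).continuousOn hφ (fun η hη => ?_) ht1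
  simp only [Function.comp_apply]
  rw [hpairing η hη.le]
  exact h.norm_circlePairing_rotation_le hf hs hf1 hρ hη

end PairingBound

section PolynomialApproximation

theorem exists_eq_eval_add_conj_eval_of_mem_span_fourier {T : ℝ} {g : C(AddCircle T, ℂ)}
    (hg : g ∈ Submodule.span ℂ (range (@fourier T))) :
    ∃ P Q : Polynomial ℂ, ∀ x : AddCircle T,
      g x = P.eval (x.toCircle : ℂ) + conj (Q.eval (x.toCircle : ℂ)) := by
  induction hg using Submodule.span_induction with
  | mem g hg =>
    obtain ⟨n, rfl⟩ := hg
    obtain ⟨m, rfl | rfl⟩ := n.eq_nat_or_neg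
    · exact ⟨Polynomial.X ^ m, 0, fun x => by simp [fourier_apply, AddCircle.toCircle_nsmul]⟩
    · refine ⟨0, Polynomial.X ^ m, fun x => ?_⟩
      rw [fourier_neg]
      simp [fourier_apply, AddCircle.toCircle_nsmul]
  | zero => exact ⟨0, 0, fun x => by simp⟩
  | add g₁ g₂ _ _ h₁ h₂ =>
    obtain ⟨P₁, Q₁, h₁⟩ := h₁
    obtain ⟨P₂, Q₂, h₂⟩ := h₂
    refine ⟨P₁ + P₂, Q₁ + Q₂, fun x => ?_⟩
    simp only [ContinuousMap.add_apply, h₁, h₂, Polynomial.eval_add, map_add]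
    ring
  | smul c g _ h =>
    obtain ⟨P, Q, h⟩ := h
    refine ⟨Polynomial.C c * P, Polynomial.C (conj c) * Q, fun x => ?_⟩
    simp only [ContinuousMap.smul_apply, h, smul_eq_mul, Polynomial.eval_mul, Polynomial.eval_C,
      map_mul, Complex.conj_conj]
    ring

theorem exists_norm_sub_eval_add_conj_eval_le {u : ℂ → ℂ} (hu : ContinuousOn u (sphere 0 1)) {ε : ℝ}
    (hε : 0 < ε) :
    ∃ P Q : Polynomial ℂ, ∀ z : ℂ, ‖z‖ = 1 → ‖u z - (P.eval z + conj (Q.eval z))‖ ≤ ε := by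
  have : Fact (0 < 2 * Real.pi) := ⟨Real.two_pi_pos⟩
  let U : C(AddCircle (2 * Real.pi), ℂ) := ⟨fun x => u (x.toCircle : ℂ),
    hu.comp_continuous (continuous_subtype_val.comp AddCircle.continuous_toCircle)
      fun x => mem_sphere_zero_iff_norm.2 (Circle.norm_coe _)⟩
  have hdense : U ∈ closure (Submodule.span ℂ (range (@fourier (2 * Real.pi))) :
      Set C(AddCircle (2 * Real.pi), ℂ)) := by
    rw [← Submodule.topologicalClosure_coe, span_fourier_closure_eq_top]
    trivial
  obtain ⟨g, hg, hUg⟩ := Metric.mem_closure_iff.1 hdense ε hε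
  obtain ⟨P, Q, hPQ⟩ := exists_eq_eval_add_conj_eval_of_mem_span_fourier hg
  refine ⟨P, Q, fun z hz => ?_⟩
  obtain ⟨θ, rfl⟩ := (Complex.norm_eq_one_iff z).1 hz
  have hθ : (AddCircle.toCircle (θ : AddCircle (2 * Real.pi)) : ℂ) =
      Complex.exp (θ * Complex.I) := by
    rw [AddCircle.toCircle_apply_mk, Circle.coe_exp, div_self Real.two_pi_pos.ne', one_mul]
  have hdist := (ContinuousMap.dist_lt_iff hε).1 hUg (θ : AddCircle (2 * Real.pi))
  rw [hPQ, dist_eq_norm] at hdist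
  simp only [U, ContinuousMap.coe_mk, hθ] at hdist
  exact hdist.le

theorem exists_eval_eq_pow_mul_conj_eval (Q : Polynomial ℂ) :
    ∃ (N : ℕ) (R : Polynomial ℂ), ∀ z : ℂ, ‖z‖ = 1 → R.eval z = z ^ N * conj (Q.eval z) := by
  induction Q using Polynomial.induction_on' with
  | add Q₁ Q₂ h₁ h₂ =>
    obtain ⟨N₁, R₁, h₁⟩ := h₁
    obtain ⟨N₂, R₂, h₂⟩ := h₂
    refine ⟨N₁ + N₂, Polynomial.X ^ N₂ * R₁ + Polynomial.X ^ N₁ * R₂, fun z hz => ?_⟩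
    simp only [Polynomial.eval_add, Polynomial.eval_mul, Polynomial.eval_pow, Polynomial.eval_X,
      h₁ z hz, h₂ z hz, map_add]
    ring
  | monomial n c =>
    refine ⟨n, Polynomial.C (conj c), fun z hz => ?_⟩
    have hzz : z * conj z = 1 := by rw [mul_conj_eq_sq_of_norm_eq hz]; simp
    rw [Polynomial.eval_C, Polynomial.eval_monomial, map_mul, map_pow, mul_left_comm, ← mul_pow,
      hzz, one_pow, mul_one]

theorem exists_norm_conj_pow_mul_eval_sub_le {u : ℂ → ℂ} (hu : ContinuousOn u (sphere 0 1)) {ε : ℝ}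
    (hε : 0 < ε) :
    ∃ (N : ℕ) (P : Polynomial ℂ), ∀ z : ℂ, ‖z‖ = 1 → ‖conj z ^ N * P.eval z - u z‖ ≤ ε := by
  obtain ⟨P, Q, hPQ⟩ := exists_norm_sub_eval_add_conj_eval_le hu hε
  obtain ⟨N, R, hR⟩ := exists_eval_eq_pow_mul_conj_eval Q
  refine ⟨N, Polynomial.X ^ N * P + R, fun z hz => ?_⟩
  have hzz : conj z * z = 1 := by rw [mul_comm, mul_conj_eq_sq_of_norm_eq hz]; simp
  have hcancel : conj z ^ N * z ^ N = 1 := by rw [← mul_pow, hzz, one_pow]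
  rw [Polynomial.eval_add, Polynomial.eval_mul, Polynomial.eval_pow, Polynomial.eval_X, hR z hz,
    ← mul_add, ← mul_assoc, hcancel, one_mul, norm_sub_rev]
  exact hPQ z hz

theorem exists_abs_re_eval_sub_le {u : ℂ → ℝ} (hu : ContinuousOn u (sphere 0 1)) {ε : ℝ}
    (hε : 0 < ε) : ∃ P : Polynomial ℂ, ∀ z : ℂ, ‖z‖ = 1 → |(P.eval z).re - u z| ≤ ε := by
  obtain ⟨P, Q, hPQ⟩ := exists_norm_sub_eval_add_conj_eval_le
    (Complex.continuous_ofReal.comp_continuousOn hu) hε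
  refine ⟨P + Q, fun z hz => ?_⟩
  have hre : (P.eval z + Q.eval z).re = (P.eval z + conj (Q.eval z)).re := by simp
  rw [Polynomial.eval_add, hre, abs_sub_comm]
  exact (Complex.abs_re_le_norm (u z - (P.eval z + conj (Q.eval z)))).trans (hPQ z hz)

theorem exists_seq_tendsto_conj_pow_mul_eval {u : ℂ → ℂ} (hu : ContinuousOn u (sphere 0 1)) :
    ∃ (N : ℕ → ℕ) (P : ℕ → Polynomial ℂ) (K : ℝ),
      (∀ n z, ‖z‖ = 1 → ‖conj z ^ N n * (P n).eval z‖ ≤ K) ∧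
      ∀ z, ‖z‖ = 1 → Tendsto (fun n => conj z ^ N n * (P n).eval z) atTop (𝓝 (u z)) := by
  obtain ⟨K, hK⟩ := (isCompact_sphere (0 : ℂ) 1).exists_bound_of_continuousOn hu
  choose N P hP using fun n : ℕ =>
    exists_norm_conj_pow_mul_eval_sub_le hu (Nat.one_div_pos_of_nat (α := ℝ) (n := n))
  refine ⟨N, P, K + 1, fun n z hz => ?_, fun z hz => ?_⟩
  · calc ‖conj z ^ N n * (P n).eval z‖
        ≤ ‖u z‖ + ‖conj z ^ N n * (P n).eval z - u z‖ := norm_le_norm_add_norm_sub' _ _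
      _ ≤ K + 1 := by
        refine add_le_add (hK z (mem_sphere_zero_iff_norm.2 hz)) ((hP n z hz).trans ?_)
        exact (div_le_one₀ (by positivity)).2 (le_add_of_nonneg_left n.cast_nonneg)
  · exact tendsto_iff_norm_sub_tendsto_zero.2 <| squeeze_zero (fun _ => norm_nonneg _)
      (fun n => hP n z hz) tendsto_one_div_add_atTop_nhds_zero_nat

/-- Multiplied by powers of `conj z`, the test polynomials are dense in `L²` of the circle. -/
theorem circleNormSq_le_sq_of_forall_polynomial {u : ℂ → ℂ} {C : ℝ}
    (hu : ContinuousOn u (sphere 0 1))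
    (h : ∀ (N : ℕ) (P : Polynomial ℂ), ‖circlePairing (fun z => z ^ N * u z) P.eval 1‖ ≤
      C * √(circleNormSq P.eval 1)) :
    circleNormSq u 1 ≤ C ^ 2 := by
  obtain ⟨M, hM⟩ := (isCompact_sphere (0 : ℂ) 1).exists_bound_of_continuousOn hu
  replace hM (z : ℂ) (hz : ‖z‖ = 1) : ‖u z‖ ≤ M := hM z (mem_sphere_zero_iff_norm.2 hz)
  obtain ⟨N, P, K, hK, hlim⟩ := exists_seq_tendsto_conj_pow_mul_eval hu
  set w : ℕ → ℂ → ℂ := fun n z => conj z ^ N n * (P n).eval z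
  have hw (n : ℕ) : Continuous (w n) := (Complex.continuous_conj.pow _).mul (P n).continuous
  have hpairing : Tendsto (fun n => circlePairing u (w n) 1) atTop (𝓝 (circlePairing u u 1)) := by
    refine tendsto_circleAverage_of_bounded_of_forall (M := M * K) zero_le_one
      (.of_forall fun n => hu.mul (Complex.continuous_conj.comp (hw n)).continuousOn)
      (.of_forall fun n z hz => ?_)
      fun z hz => ((Complex.continuous_conj.tendsto _).comp (hlim z hz)).const_mul _
    rw [norm_mul, RCLike.norm_conj]
    exact mul_le_mul (hM z hz) (hK n z hz) (norm_nonneg _) ((norm_nonneg _).trans (hM z hz))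
  have hnorm : Tendsto (fun n => circleNormSq (w n) 1) atTop (𝓝 (circleNormSq u 1)) :=
    tendsto_circleAverage_of_bounded_of_forall (M := K ^ 2) zero_le_one
      (.of_forall fun n => ((hw n).norm.pow 2).continuousOn)
      (.of_forall fun n z hz => by
        rw [norm_pow, norm_norm]
        exact pow_le_pow_left₀ (norm_nonneg _) (hK n z hz) 2)
      fun z hz => (hlim z hz).norm.pow 2
  have hle : ‖circlePairing u u 1‖ ≤ C * √(circleNormSq u 1) := by
    refine le_of_tendsto_of_tendsto' hpairing.norm (hnorm.sqrt.const_mul C) fun n => ?_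
    have hp : circlePairing u (w n) 1 = circlePairing (fun z => z ^ N n * u z) (P n).eval 1 :=
      circleAverage_congr_of_norm_eq zero_le_one fun z _ => by
        simp only [w, map_mul, map_pow, Complex.conj_conj]
        ring
    have hn : circleNormSq (w n) 1 = circleNormSq (P n).eval 1 :=
      circleAverage_congr_of_norm_eq zero_le_one fun z hz => by simp [w, hz]
    exact hp ▸ hn ▸ h (N n) (P n)
  have hX := circleNormSq_nonneg u 1
  rw [circlePairing_self zero_le_one hu, Complex.norm_real, Real.norm_of_nonneg hX] at hle
  obtain hzero | hpos := hX.eq_or_lt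
  · exact hzero ▸ sq_nonneg C
  · refine (Real.sqrt_le_iff.1 (le_of_mul_le_mul_right ?_ (Real.sqrt_pos.2 hpos))).2
    rwa [Real.mul_self_sqrt hX]

theorem HasPairingBound.circleNormSq_mul_le {p C : ℝ} {φ : ℂ → ℂ} (h : HasPairingBound p φ C)
    (hφ : DifferentiableOn ℂ φ (ball 0 1)) {t : ℝ} (ht : t ∈ Ioo (0 : ℝ) 1) {f : ℂ → ℂ}
    (hf : Differentiable ℂ f) (hf1 : Real.circleAverage (fun z => ‖f z‖ ^ p) 0 1 ≤ 1) :
    circleNormSq (fun z => φ (t * z) * f z) 1 ≤ C ^ 2 := by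
  have hcφ : ContinuousOn (fun z => φ (t * z)) (sphere 0 1) :=
    continuousOn_sphere_of_differentiableOn (differentiableOn_comp_ofReal_mul hφ ht.1)
      ((one_lt_div ht.1).2 ht.2)
  have hconj : circleNormSq (fun z => φ (t * z) * f z) 1 =
      circleNormSq (fun z => f z * conj (φ (t * z))) 1 :=
    circleAverage_congr_of_norm_eq zero_le_one fun z _ => by
      simp only [norm_mul, RCLike.norm_conj, mul_comm]
  rw [hconj]
  refine circleNormSq_le_sq_of_forall_polynomial
    (hf.continuous.continuousOn.mul (Complex.continuous_conj.comp_continuousOn hcφ)) fun N P => ?_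
  have hshift : Real.circleAverage (fun z => ‖z ^ N * f z‖ ^ p) 0 1 ≤ 1 := by
    refine (circleAverage_congr_of_norm_eq zero_le_one fun z hz => ?_).trans_le hf1
    rw [norm_mul, norm_pow, hz, one_pow, one_mul]
  convert h.norm_circlePairing_dilation_le hφ ht ((differentiable_id.pow N).mul hf)
    P.differentiable hshift using 2
  refine circleAverage_congr_of_norm_eq zero_le_one fun z _ => ?_
  simp only [map_mul, Pi.mul_apply, Pi.pow_apply]
  ring

end PolynomialApproximation

section MultiplierBound

variable {p r : ℝ}

theorem holderConjugate_half_div_sub_two (hp : 2 < p) : (p / 2).HolderConjugate (p / (p - 2)) := by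
  have : p - 2 ≠ 0 := by linarith
  have : p ≠ 0 := by linarith
  rw [Real.holderConjugate_iff]
  refine ⟨by linarith, ?_⟩
  field_simp
  ring

theorem norm_sq_rpow (w : ℂ) (s : ℝ) : (‖w‖ ^ 2) ^ s = ‖w‖ ^ (2 * s) := by
  rw [← Real.rpow_natCast, ← Real.rpow_mul (norm_nonneg _), Nat.cast_ofNat]

theorem circleNormSq_mul_le_rpow_mul_rpow (hp : 2 < p) {f g : ℂ → ℂ} (hr : 0 ≤ r)
    (hf : ContinuousOn f (sphere 0 r)) (hg : ContinuousOn g (sphere 0 r)) :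
    circleNormSq (fun z => f z * g z) r ≤
      Real.circleAverage (fun z => ‖f z‖ ^ p) 0 r ^ (2 / p) *
        Real.circleAverage (fun z => ‖g z‖ ^ (2 * p / (p - 2))) 0 r ^ ((p - 2) / p) := by
  have hholder := circleAverage_mul_le_rpow_mul_rpow (F := fun z => ‖f z‖ ^ 2)
    (G := fun z => ‖g z‖ ^ 2) (holderConjugate_half_div_sub_two hp) hr (hf.norm.pow 2)
    (hg.norm.pow 2) (fun z => sq_nonneg _) (fun z => sq_nonneg _)
  simpa only [circleNormSq, norm_sq_rpow, mul_div_cancel₀ p two_ne_zero, ← mul_div_assoc,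
    mul_div_cancel_left₀ p (two_ne_zero' ℝ), one_div_div, ← mul_pow, ← norm_mul] using hholder

theorem circleNormSq_le_rpow (hp : 2 < p) {f : ℂ → ℂ} (hr : 0 ≤ r)
    (hf : ContinuousOn f (sphere 0 r)) :
    circleNormSq f r ≤ Real.circleAverage (fun z => ‖f z‖ ^ p) 0 r ^ (2 / p) := by
  have hmul := circleNormSq_mul_le_rpow_mul_rpow hp hr hf (continuousOn_const (c := (1 : ℂ)))
  simpa only [mul_one, norm_one, Real.one_rpow, Real.circleAverage_const] using hmul

theorem circleAverage_pos {F : ℂ → ℝ} (hr : 0 ≤ r) (hF : ContinuousOn F (sphere 0 r))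
    (hpos : ∀ z, ‖z‖ = r → 0 < F z) : 0 < Real.circleAverage F 0 r := by
  obtain ⟨z₀, hz₀, hmin⟩ := (isCompact_sphere (0 : ℂ) r).exists_isMinOn
    ⟨(r : ℂ), by simp [abs_of_nonneg hr]⟩ hF
  calc 0 < F z₀ := hpos z₀ (mem_sphere_zero_iff_norm.1 hz₀)
    _ = Real.circleAverage (fun _ => F z₀) 0 r := (Real.circleAverage_const _ _ _).symm
    _ ≤ Real.circleAverage F 0 r := circleAverage_mono_of_continuousOn hr continuousOn_const hF
        fun z hz => hmin (mem_sphere_zero_iff_norm.2 hz)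

theorem HasPairingBound.circleNormSq_mul_le_rpow {C : ℝ} {φ : ℂ → ℂ} (h : HasPairingBound p φ C)
    (hp : 0 < p) (hφ : DifferentiableOn ℂ φ (ball 0 1)) {t : ℝ} (ht : t ∈ Ioo (0 : ℝ) 1) {f : ℂ → ℂ}
    (hf : Differentiable ℂ f) (hpos : 0 < Real.circleAverage (fun z => ‖f z‖ ^ p) 0 1) :
    circleNormSq (fun z => φ (t * z) * f z) 1 ≤
      C ^ 2 * Real.circleAverage (fun z => ‖f z‖ ^ p) 0 1 ^ (2 / p) := by
  set m := Real.circleAverage (fun z => ‖f z‖ ^ p) 0 1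
  set κ : ℝ := m ^ (-1 / p)
  have hκ : 0 < κ := Real.rpow_pos_of_pos hpos _
  have hκp : κ ^ p = m⁻¹ := by
    rw [← Real.rpow_mul hpos.le, div_mul_cancel₀ _ hp.ne', Real.rpow_neg_one]
  have hκ2 : κ ^ 2 = (m ^ (2 / p))⁻¹ := by
    rw [← Real.rpow_natCast, ← Real.rpow_mul hpos.le, ← Real.rpow_neg hpos.le]
    congr 1
    push_cast
    ring
  have hnorm (w : ℂ) : ‖(κ : ℂ) * w‖ = κ * ‖w‖ := by
    rw [norm_mul, Complex.norm_real, Real.norm_of_nonneg hκ.le]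
  have hunit : Real.circleAverage (fun z => ‖(κ : ℂ) * f z‖ ^ p) 0 1 = 1 := by
    simp_rw [hnorm, Real.mul_rpow hκ.le (norm_nonneg _), ← smul_eq_mul]
    rw [Real.circleAverage_fun_smul, hκp, smul_eq_mul, inv_mul_cancel₀ hpos.ne']
  have hscale : circleNormSq (fun z => φ (t * z) * (κ * f z)) 1 =
      κ ^ 2 * circleNormSq (fun z => φ (t * z) * f z) 1 := by
    unfold circleNormSq
    simp_rw [mul_left_comm _ (κ : ℂ), hnorm, mul_pow κ, ← smul_eq_mul (κ ^ 2)]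
    rw [Real.circleAverage_fun_smul]
  have hbound := h.circleNormSq_mul_le hφ ht (hf.const_mul (κ : ℂ)) hunit.le
  rwa [hscale, hκ2, inv_mul_le_iff₀ (Real.rpow_pos_of_pos hpos _), mul_comm] at hbound

theorem exists_seq_tendsto_norm_cexp_eval {w : ℂ → ℝ} (hw : ContinuousOn w (sphere 0 1))
    (hpos : ∀ z, ‖z‖ = 1 → 0 < w z) :
    ∃ (Q : ℕ → Polynomial ℂ) (M : ℝ), (∀ n z, ‖z‖ = 1 → ‖Complex.exp ((Q n).eval z)‖ ≤ M) ∧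
      ∀ z, ‖z‖ = 1 → Tendsto (fun n => ‖Complex.exp ((Q n).eval z)‖) atTop (𝓝 (w z)) := by
  have hlog : ContinuousOn (fun z => Real.log (w z)) (sphere 0 1) :=
    hw.log fun z hz => (hpos z (mem_sphere_zero_iff_norm.1 hz)).ne'
  obtain ⟨K, hK⟩ := (isCompact_sphere (0 : ℂ) 1).exists_bound_of_continuousOn hlog
  choose Q hQ using fun n : ℕ =>
    exists_abs_re_eval_sub_le hlog (Nat.one_div_pos_of_nat (α := ℝ) (n := n))
  refine ⟨Q, Real.exp (K + 1), fun n z hz => ?_, fun z hz => ?_⟩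
  · have hn : 1 / ((n : ℝ) + 1) ≤ 1 :=
      (div_le_one₀ (by positivity)).2 (le_add_of_nonneg_left n.cast_nonneg)
    rw [Complex.norm_exp, Real.exp_le_exp]
    linarith [(abs_le.1 (hQ n z hz)).2, (abs_le.1 (hK z (mem_sphere_zero_iff_norm.2 hz))).2]
  · have hre : Tendsto (fun n => ((Q n).eval z).re) atTop (𝓝 (Real.log (w z))) :=
      tendsto_iff_norm_sub_tendsto_zero.2 <| squeeze_zero (fun _ => norm_nonneg _)
        (fun n => hQ n z hz) tendsto_one_div_add_atTop_nhds_zero_nat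
    have hexp := (Real.continuous_exp.tendsto _).comp hre
    rw [Real.exp_log (hpos z hz)] at hexp
    exact hexp.congr fun n => (Complex.norm_exp _).symm

theorem circleAverage_mul_sq_le_of_forall_cexp {W w : ℂ → ℝ} {K : ℝ} (hp : 0 < p)
    (hW : ContinuousOn W (sphere 0 1))
    (h : ∀ Q : Polynomial ℂ, Real.circleAverage (fun z => W z * ‖Complex.exp (Q.eval z)‖ ^ 2) 0 1 ≤
      K * Real.circleAverage (fun z => ‖Complex.exp (Q.eval z)‖ ^ p) 0 1 ^ (2 / p))
    (hw : ContinuousOn w (sphere 0 1)) (hpos : ∀ z, ‖z‖ = 1 → 0 < w z) :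
    Real.circleAverage (fun z => W z * w z ^ 2) 0 1 ≤
      K * Real.circleAverage (fun z => w z ^ p) 0 1 ^ (2 / p) := by
  obtain ⟨N, hN⟩ := (isCompact_sphere (0 : ℂ) 1).exists_bound_of_continuousOn hW
  obtain ⟨Q, M, hM, hlim⟩ := exists_seq_tendsto_norm_cexp_eval hw hpos
  have hQ (n : ℕ) : Continuous fun z => ‖Complex.exp ((Q n).eval z)‖ :=
    (Q n).continuous.cexp.norm
  have hleft : Tendsto
      (fun n => Real.circleAverage (fun z => W z * ‖Complex.exp ((Q n).eval z)‖ ^ 2) 0 1) atTop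
      (𝓝 (Real.circleAverage (fun z => W z * w z ^ 2) 0 1)) := by
    refine tendsto_circleAverage_of_bounded_of_forall (M := N * M ^ 2) zero_le_one
      (.of_forall fun n => hW.mul ((hQ n).pow 2).continuousOn) (.of_forall fun n z hz => ?_)
      fun z hz => ((hlim z hz).pow 2).const_mul _
    have hNz := hN z (mem_sphere_zero_iff_norm.2 hz)
    rw [norm_mul, norm_pow, norm_norm]
    exact mul_le_mul hNz (pow_le_pow_left₀ (norm_nonneg _) (hM n z hz) 2) (by positivity)
      ((norm_nonneg _).trans hNz)
  have hright : Tendsto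
      (fun n => Real.circleAverage (fun z => ‖Complex.exp ((Q n).eval z)‖ ^ p) 0 1) atTop
      (𝓝 (Real.circleAverage (fun z => w z ^ p) 0 1)) := by
    refine tendsto_circleAverage_of_bounded_of_forall (M := M ^ p) zero_le_one
      (.of_forall fun n => ((hQ n).rpow_const fun _ => .inr hp.le).continuousOn)
      (.of_forall fun n z hz => ?_) fun z hz => (hlim z hz).rpow_const (.inr hp.le)
    rw [Real.norm_of_nonneg (by positivity)]
    exact Real.rpow_le_rpow (norm_nonneg _) (hM n z hz) hp.le
  exact le_of_tendsto_of_tendsto' hleft ((hright.rpow_const (.inr (by positivity))).const_mul K)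
    fun n => h (Q n)

/-- The weight `W ^ (1 / (p - 2))` is extremal in Hölder's inequality. -/
theorem circleAverage_rpow_le_of_forall_cexp {W : ℂ → ℝ} {K : ℝ} (hp : 2 < p) (hK : 0 ≤ K)
    (hW : ContinuousOn W (sphere 0 1)) (hpos : ∀ z, ‖z‖ = 1 → 0 < W z)
    (h : ∀ Q : Polynomial ℂ, Real.circleAverage (fun z => W z * ‖Complex.exp (Q.eval z)‖ ^ 2) 0 1 ≤
      K * Real.circleAverage (fun z => ‖Complex.exp (Q.eval z)‖ ^ p) 0 1 ^ (2 / p)) :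
    Real.circleAverage (fun z => W z ^ (p / (p - 2))) 0 1 ≤ K ^ (p / (p - 2)) := by
  have hpq := holderConjugate_half_div_sub_two hp
  have hp2 : p - 2 ≠ 0 := by linarith
  have hWne (z : ℂ) (hz : z ∈ sphere (0 : ℂ) 1) : W z ≠ 0 :=
    (hpos z (mem_sphere_zero_iff_norm.1 hz)).ne'
  have hcW (s : ℝ) : ContinuousOn (fun z => W z ^ s) (sphere 0 1) :=
    hW.rpow_const fun z hz => .inl (hWne z hz)
  have hle := circleAverage_mul_sq_le_of_forall_cexp (by linarith) hW h (hcW (1 / (p - 2)))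
    fun z hz => Real.rpow_pos_of_pos (hpos z hz) _
  have hleft : Real.circleAverage (fun z => W z * (W z ^ (1 / (p - 2))) ^ 2) 0 1 =
      Real.circleAverage (fun z => W z ^ (p / (p - 2))) 0 1 :=
    circleAverage_congr_of_norm_eq zero_le_one fun z hz => by
      have hexp : p / (p - 2) = 1 + 1 / (p - 2) * (2 : ℕ) := by
        field_simp
        push_cast
        ring
      rw [hexp, Real.rpow_add (hpos z hz), Real.rpow_one, Real.rpow_mul (hpos z hz).le,
        Real.rpow_natCast]
  have hright : Real.circleAverage (fun z => (W z ^ (1 / (p - 2))) ^ p) 0 1 =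
      Real.circleAverage (fun z => W z ^ (p / (p - 2))) 0 1 :=
    circleAverage_congr_of_norm_eq zero_le_one fun z hz => by
      rw [← Real.rpow_mul (hpos z hz).le, one_div_mul_eq_div]
  have hI : 0 ≤ Real.circleAverage (fun z => W z ^ (p / (p - 2))) 0 1 :=
    (circleAverage_pos zero_le_one (hcW _) fun z hz => Real.rpow_pos_of_pos (hpos z hz) _).le
  refine le_of_le_rpow_mul_rpow hpq.symm hI (by positivity) ?_
  rw [hleft, hright] at hle
  rwa [one_div (p / (p - 2)), Real.rpow_rpow_inv hK hpq.symm.ne_zero, one_div_div, mul_comm]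

theorem HasPairingBound.circleAverage_mul_norm_cexp_sq_le {C : ℝ} {φ : ℂ → ℂ}
    (h : HasPairingBound p φ C) (hp : 2 < p) (hφ : DifferentiableOn ℂ φ (ball 0 1)) {t : ℝ}
    (ht : t ∈ Ioo (0 : ℝ) 1) (Q : Polynomial ℂ) :
    Real.circleAverage (fun z => (1 + ‖φ (t * z)‖ ^ 2) * ‖Complex.exp (Q.eval z)‖ ^ 2) 0 1 ≤
      (1 + C ^ 2) * Real.circleAverage (fun z => ‖Complex.exp (Q.eval z)‖ ^ p) 0 1 ^ (2 / p) := by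
  have hcφ := continuousOn_sphere_of_differentiableOn (differentiableOn_comp_ofReal_mul hφ ht.1)
    ((one_lt_div ht.1).2 ht.2)
  have hf : Differentiable ℂ fun z => Complex.exp (Q.eval z) := Q.differentiable.cexp
  have hcf := hf.continuous.continuousOn (s := sphere 0 1)
  have hm : 0 < Real.circleAverage (fun z => ‖Complex.exp (Q.eval z)‖ ^ p) 0 1 :=
    circleAverage_pos zero_le_one (hcf.norm.rpow_const fun _ _ => .inr (by linarith))
      fun z _ => Real.rpow_pos_of_pos (norm_pos_iff.2 (Complex.exp_ne_zero _)) _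
  have hsum : Real.circleAverage
      (fun z => (1 + ‖φ (t * z)‖ ^ 2) * ‖Complex.exp (Q.eval z)‖ ^ 2) 0 1 =
      circleNormSq (fun z => Complex.exp (Q.eval z)) 1 +
        circleNormSq (fun z => φ (t * z) * Complex.exp (Q.eval z)) 1 := by
    simp only [circleNormSq, norm_mul, mul_pow, add_mul, one_mul]
    exact Real.circleAverage_fun_add ((hcf.norm.pow 2).circleIntegrable zero_le_one)
      (((hcφ.norm.pow 2).mul (hcf.norm.pow 2)).circleIntegrable zero_le_one)
  rw [hsum, add_mul, one_mul]
  exact add_le_add (circleNormSq_le_rpow hp zero_le_one hcf)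
    (h.circleNormSq_mul_le_rpow (by linarith) hφ ht hf hm)

theorem HasPairingBound.circleAverage_rpow_le {C : ℝ} {φ : ℂ → ℂ} (h : HasPairingBound p φ C)
    (hp : 2 < p) (hφ : DifferentiableOn ℂ φ (ball 0 1)) {t : ℝ} (ht : t ∈ Ioo (0 : ℝ) 1) :
    Real.circleAverage (fun z => ‖φ z‖ ^ (2 * p / (p - 2))) 0 t ≤
      (1 + C ^ 2) ^ (p / (p - 2)) := by
  have hexp : 0 ≤ p / (p - 2) := div_nonneg (by linarith) (by linarith)
  have hcφ := continuousOn_sphere_of_differentiableOn (differentiableOn_comp_ofReal_mul hφ ht.1)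
    ((one_lt_div ht.1).2 ht.2)
  have hcW : ContinuousOn (fun z => 1 + ‖φ (t * z)‖ ^ 2) (sphere 0 1) :=
    continuousOn_const.add (hcφ.norm.pow 2)
  calc Real.circleAverage (fun z => ‖φ z‖ ^ (2 * p / (p - 2))) 0 t
      = Real.circleAverage (fun z => (‖φ (t * z)‖ ^ 2) ^ (p / (p - 2))) 0 1 := by
        simp_rw [norm_sq_rpow, ← mul_div_assoc]
        rw [circleAverage_comp_ofReal_mul (fun z => ‖φ z‖ ^ (2 * p / (p - 2))), mul_one]
    _ ≤ Real.circleAverage (fun z => (1 + ‖φ (t * z)‖ ^ 2) ^ (p / (p - 2))) 0 1 :=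
        circleAverage_mono_of_continuousOn zero_le_one
          ((hcφ.norm.pow 2).rpow_const fun _ _ => .inr hexp)
          (hcW.rpow_const fun _ _ => .inr hexp)
          fun z _ => Real.rpow_le_rpow (sq_nonneg _) (le_add_of_nonneg_left zero_le_one) hexp
    _ ≤ (1 + C ^ 2) ^ (p / (p - 2)) :=
        circleAverage_rpow_le_of_forall_cexp hp (by positivity) hcW (fun z _ => by positivity)
          (h.circleAverage_mul_norm_cexp_sq_le hp hφ ht)

end MultiplierBound

section Containment

theorem IsPythagoreanMate.isPythagoreanPair {a : 𝔻 → ℂ} {b : hInftyUnitBall}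
    (h : IsPythagoreanMate a b) : IsPythagoreanPair (discExt a) (discExt (b : 𝔻 → ℂ)) where
  differentiableOn_left := h.1.1
  differentiableOn_right := b.2.1
  norm_left_le := norm_discExt_le_of_norm_le zero_le_one h.1.2
  norm_right_le := norm_discExt_le_of_norm_le zero_le_one b.2.2
  radial := h.2.2

theorem IsOuter.discExt_ne_zero {f : 𝔻 → ℂ} (hf : IsOuter f) {z : ℂ} (hz : ‖z‖ < 1) :
    discExt f z ≠ 0 := by
  obtain ⟨c, u, hc, -, h⟩ := hf
  rw [discExt, dif_pos hz, h]
  exact mul_ne_zero (norm_ne_zero_iff.1 (hc ▸ one_ne_zero)) (Complex.exp_ne_zero _)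

theorem discExt_div (f g : 𝔻 → ℂ) (z : ℂ) :
    discExt (fun w => f w / g w) z = discExt f z / discExt g z := by
  unfold discExt
  split_ifs <;> simp

theorem IsOuter.discExt_mul_discExt_div {a : 𝔻 → ℂ} (ha : IsOuter a) (b : 𝔻 → ℂ) {z : ℂ}
    (hz : ‖z‖ < 1) : discExt a z * discExt (fun w => b w / a w) z = discExt b z := by
  rw [discExt_div, mul_div_cancel₀ _ (ha.discExt_ne_zero hz)]

theorem IsOuter.isAnalyticOnDisc_div {a b : 𝔻 → ℂ} (ha : IsOuter a) (had : IsAnalyticOnDisc a)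
    (hb : IsAnalyticOnDisc b) : IsAnalyticOnDisc fun z => b z / a z :=
  (hb.fun_div had fun _ hz => ha.discExt_ne_zero (mem_ball_zero_iff.1 hz)).congr
    fun z _ => discExt_div b a z

theorem hardyMean_nonneg (p : ℝ) (f : 𝔻 → ℂ) (r : ℝ) : 0 ≤ hardyMean p f r :=
  Real.circleAverage_nonneg_of_nonneg fun _ _ => by positivity

theorem exists_hardyMean_le {p : ℝ} {f : 𝔻 → ℂ} (hf : f ∈ hardySpace p) :
    ∃ M, 0 ≤ M ∧ ∀ r ∈ Ioo (0 : ℝ) 1, hardyMean p f r ≤ M := by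
  obtain ⟨M, hM⟩ := hf.2
  exact ⟨max 0 M, le_max_left _ _, fun r hr => (hM ⟨r, hr, rfl⟩).trans (le_max_right _ _)⟩

variable {b : hInftyUnitBall} {a : 𝔻 → ℂ} {p : ℝ}

theorem hardySpace_subset_dbrFunctions (ha : IsPythagoreanMate a b) (hp : 2 < p)
    (hφ : (fun z => (b : 𝔻 → ℂ) z / a z) ∈ hardySpace (2 * p / (p - 2))) :
    hardySpace p ⊆ dbrFunctions b := by
  intro f hf
  obtain ⟨M, hM0, hM⟩ := exists_hardyMean_le hf
  obtain ⟨N, -, hN⟩ := exists_hardyMean_le hφ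
  refine mem_dbrFunctions_of_circleNormSq_le ha.isPythagoreanPair hf.1 hφ.1.continuousOn
    (fun z hz => ha.2.1.discExt_mul_discExt_div _ hz)
    (C := M ^ (2 / p) + M ^ (2 / p) * N ^ ((p - 2) / p)) fun r hr => ?_
  have hcf := continuousOn_sphere_of_differentiableOn hf.1 hr.2
  have hcφ := continuousOn_sphere_of_differentiableOn hφ.1 hr.2
  have hfM : Real.circleAverage (fun z => ‖discExt f z‖ ^ p) 0 r ^ (2 / p) ≤ M ^ (2 / p) :=
    Real.rpow_le_rpow (hardyMean_nonneg p f r) (hM r hr) (by positivity)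
  have hφN := Real.rpow_le_rpow (hardyMean_nonneg _ _ r) (hN r hr)
    (div_nonneg (by linarith) (by linarith) : 0 ≤ (p - 2) / p)
  exact add_le_add ((circleNormSq_le_rpow hp hr.1.le hcf).trans hfM)
    ((circleNormSq_mul_le_rpow_mul_rpow hp hr.1.le hcf hcφ).trans <| mul_le_mul hfM hφN
      (Real.rpow_nonneg (hardyMean_nonneg _ _ r) _) (Real.rpow_nonneg hM0 _))

theorem div_mem_hardySpace (ha : IsPythagoreanMate a b) (hp : 2 < p)
    (hsub : hardySpace p ⊆ dbrFunctions b) :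
    (fun z => (b : 𝔻 → ℂ) z / a z) ∈ hardySpace (2 * p / (p - 2)) := by
  have hφ := ha.2.1.isAnalyticOnDisc_div ha.1.1 b.2.1
  obtain ⟨C, hC⟩ := exists_hasPairingBound hp.le ha.isPythagoreanPair ha.2.1 hsub hφ
    fun z hz => ha.2.1.discExt_mul_discExt_div _ hz
  exact ⟨hφ, (1 + C ^ 2) ^ (p / (p - 2)),
    forall_mem_image.2 fun t ht => hC.circleAverage_rpow_le hp hφ ht⟩

end Containment

section Noncompactness

variable {p : ℝ}

theorem hardyNorm_le_one_of_mem_hardyBall (hp : 0 ≤ p) {f : 𝔻 → ℂ} (hf : f ∈ hardyBall p) :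
    hardyNorm p f ≤ 1 :=
  Real.rpow_le_one (Real.sSup_nonneg (forall_mem_image.2 fun r _ => hardyMean_nonneg p f r))
    (csSup_le ((nonempty_Ioo.2 one_pos).image _) (forall_mem_image.2 hf.2)) (by positivity)

theorem circleAverage_comp_norm_discExt_pow (G : ℝ → ℝ) (n : ℕ) {r : ℝ} (hr : r ∈ Ioo (0 : ℝ) 1) :
    Real.circleAverage (fun z => G ‖discExt (fun w => (w : ℂ) ^ n) z‖) 0 r = G (r ^ n) := by
  rw [← Real.circleAverage_const (G (r ^ n)) 0 r]
  refine circleAverage_congr_of_norm_eq hr.1.le fun z hz => ?_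
  rw [discExt_comp_coe (fun w => w ^ n) (hz.trans_lt hr.2), norm_pow, hz]

theorem pow_mem_hardyBall (hp : 0 ≤ p) (n : ℕ) : (fun w : 𝔻 => (w : ℂ) ^ n) ∈ hardyBall p :=
  ⟨(differentiable_pow n).differentiableOn.congr fun _ hz =>
      discExt_comp_coe (fun w => w ^ n) (mem_ball_zero_iff.1 hz),
    fun _ hr => (circleAverage_comp_norm_discExt_pow (· ^ p) n hr).trans_le <|
      Real.rpow_le_one (pow_nonneg hr.1.le n) (pow_le_one₀ hr.1.le hr.2.le) hp⟩

variable {b : hInftyUnitBall} {A : ℂ → ℂ}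

theorem one_le_norm_of_coe_eq_pow (h : IsPythagoreanPair A (discExt (b : 𝔻 → ℂ))) {n : ℕ}
    {F : DeBrangesRovnyak b} (hF : (F : 𝔻 → ℂ) = fun w : 𝔻 => (w : ℂ) ^ n) : 1 ≤ ‖F‖ := by
  have hle (r : ℝ) (hr : r ∈ Ioo (0 : ℝ) 1) : (r ^ n) ^ 2 ≤ ‖F‖ ^ 2 := by
    rw [← circleAverage_comp_norm_discExt_pow (· ^ 2) n hr, ← hF]
    exact circleNormSq_discExt_le h F hr
  have hlim : Tendsto (fun r : ℝ => (r ^ n) ^ 2) (𝓝[<] 1) (𝓝 ((1 ^ n) ^ 2)) :=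
    (((continuous_pow n).pow 2).tendsto 1).mono_left nhdsWithin_le_nhds
  have hone := le_of_tendsto hlim (mem_of_superset (Ioo_mem_nhdsLT one_pos) hle)
  rw [one_pow, one_pow] at hone
  exact (one_le_sq_iff₀ (norm_nonneg _)).1 hone

theorem eq_zero_of_tendsto_of_coe_eq_pow {F : ℕ → DeBrangesRovnyak b} {k : ℕ → ℕ}
    (hF : ∀ n, (F n : 𝔻 → ℂ) = fun w : 𝔻 => (w : ℂ) ^ k n) (hk : Tendsto k atTop atTop)
    {L : DeBrangesRovnyak b} (hL : Tendsto F atTop (𝓝 L)) : L = 0 := by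
  refine DFunLike.coe_injective (funext fun z => ?_)
  have hLz : Tendsto (fun n => F n z) atTop (𝓝 (L z)) :=
    ((RKHS.continuous_eval (H := DeBrangesRovnyak b) z).tendsto L).comp hL
  have hzero : Tendsto (fun n => F n z) atTop (𝓝 0) :=
    ((tendsto_pow_atTop_nhds_zero_of_norm_lt_one z.norm_lt_one).comp hk).congr
      fun n => (congrFun (hF n) z).symm
  rw [tendsto_nhds_unique hLz hzero, RKHS.coe_zero, Pi.zero_apply]

theorem not_isCompactlyContained (h : IsPythagoreanPair A (discExt (b : 𝔻 → ℂ))) (hp : 0 ≤ p) :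
    ¬ IsCompactlyContained p b := by
  rintro ⟨hsub, hcompact⟩
  choose F hF using fun n => hsub (hardyBall_subset_hardySpace p (pow_mem_hardyBall hp n))
  have hF_ball (n : ℕ) : (F n : 𝔻 → ℂ) ∈ hardyBall p :=
    Set.mem_of_eq_of_mem (hF n) (pow_mem_hardyBall hp n)
  obtain ⟨L, -, k, hk, hL⟩ := hcompact.tendsto_subseq fun n => subset_closure
    ⟨hardyBall_subset_hardySpace p (hF_ball n), hardyNorm_le_one_of_mem_hardyBall hp (hF_ball n)⟩
  have hL0 : L = 0 := eq_zero_of_tendsto_of_coe_eq_pow (fun n => hF (k n)) hk.tendsto_atTop hL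
  have hL1 : 1 ≤ ‖L‖ := ge_of_tendsto' hL.norm fun n => one_le_norm_of_coe_eq_pow h (hF (k n))
  rw [hL0, norm_zero] at hL1
  exact zero_lt_one.not_ge hL1

end Noncompactness

theorem mainTheorem1 (b : hInftyUnitBall)
    (hb : (b : 𝔻 → ℂ) ∉ Set.extremePoints ℝ hInftyUnitBall)
    (a : 𝔻 → ℂ) (ha : IsPythagoreanMate a b) (p : ℝ) (hp : 2 < p) :
    (hardySpace p ⊆ dbrFunctions b ↔
      (fun z => (b : 𝔻 → ℂ) z / a z) ∈ hardySpace (2 * p / (p - 2))) ∧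
    ¬ IsCompactlyContained p b :=
  ⟨⟨div_mem_hardySpace ha hp, hardySpace_subset_dbrFunctions ha hp⟩,
    not_isCompactlyContained ha.isPythagoreanPair (by linarith)⟩

end
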